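/- Conventions. Let $n\ge 0$ and let $S_n$ be the group of permutations of $\{1,\dots,n\}$, with $w\in S_n$ written in one-line notation $w(1)w(2)\cdots w(n)$. Let $s_i$ ($1\le i\le n-1$) be the adjacent transposition of $i$ and $i+1$, and let $\ell(w)$ be the least number of $s_i$'s whose product is $w$; a word spelling such a product of length $\ell(w)$ is a reduced word of $w$. The permutation $w$ is fully commutative if any two of its reduced words are connected by interchanges of adjacent letters $i,j$ with $|i-j|>1$. The right weak order $\le$ on $S_n$ is the reflexive and transitive closure of the relations $v<vs_i$ with $\ell(v)<\ell(vs_i)$, where $vs_i$ is $v$ with the letters in positions $i$ and $i+1$ swapped. A set $L$ of integers is uncrowded if $|[y,y+2x]\cap L|\le x+1$ for all integers $x,y$ with $x>0$, and crowded otherwise. A fully commutative permutation $w$ is crowded if the set of entries in the second row of its Robinson–Schensted–Knuth insertion tableau $P(w)$ is crowded; $\mathcal{C}_n$ denotes the set of crowded fully commutative permutations in $S_n$. A descent of $w$ is an $i\in\{1,\dots,n-1\}$ with $w(i)>w(i+1)$. An occurrence in $w$ of a pattern $\sigma\in S_m$ is a subsequence $w(p_1)\cdots w(p_m)$, $p_1<\cdots<p_m$,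 in the same relative order as $\sigma(1)\cdots\sigma(m)$ (and is then called a $\sigma$-pattern); it is consecutive if $p_{j+1}=p_j+1$ for all $j$. Theorem 5.15. A permutation $w\in S_n$ is a minimal element of $\mathcal{C}_n$ with respect to the right weak order if and only if there are integers $d\ge 1$ and $k\ge 2$ such that all of the following hold. (a) The set of descents of $w$ is $\{d,d+2,d+4,\dots,d+2k\}$. (b) The set $\{w(d),w(d+2),\dots,w(d+2k)\}$ is crowded. (c) $w(i)=i$ for all $i\in[1,n]\setminus[d,d+2k+1]$. (d) The pattern $415263$ occurs in $w$, and every occurrence of $415263$ in $w$ is consecutive. (e) For each $i\in[0,k-2]$, the consecutive subsequence $w(d+2i)w(d+2i+1)\cdots w(d+2i+5)$ is a $415263$-pattern or a $315264$-pattern. -/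

import Mathlib

namespace FCPerm

/-! Permutations of `{1, …, n}` are elements of `Equiv.Perm (Fin n)`; the element `i : Fin n`
stands for the number `i + 1`. Positions and values are written with the numbers `1, …, n`
through `letter`. -/

/-- The letter `w(i)` of the one-line notation `w(1) w(2) ⋯ w(n)`, for `1 ≤ i ≤ n`
(outside this range `w` is extended by `w(i) = i`). -/
def letter {n : ℕ} (w : Equiv.Perm (Fin n)) (i : ℕ) : ℕ :=
  if h : 1 ≤ i ∧ i ≤ n then (w ⟨i - 1, by omega⟩ : ℕ) + 1 else i

/-- The one-line notation of `w`, as a word in the letters `1, …, n`. -/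
def oneLine {n : ℕ} (w : Equiv.Perm (Fin n)) : List ℕ :=
  List.ofFn fun i : Fin n => (w i : ℕ) + 1

/-! ### Reduced words, full commutativity, right weak order -/

/-- The simple reflections of `S_n`: the index `i : Fin (n - 1)` stands for `s_{i+1}`, which
swaps the numbers `i + 1` and `i + 2`, that is, the elements `i` and `i + 1` of `Fin n`. -/
def simpleReflection {n : ℕ} (i : Fin (n - 1)) : Equiv.Perm (Fin n) :=
  Equiv.swap ⟨i, by omega⟩ ⟨i + 1, by omega⟩

/-- The product of simple reflections spelled by a word. As usual, products act from the right:
`w * s_i` is obtained from `w` by swapping the letters in positions `i` and `i + 1`. -/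
def wordProd {n : ℕ} (u : List (Fin (n - 1))) : Equiv.Perm (Fin n) :=
  (u.map simpleReflection).prod

/-- The Coxeter length: the least number of simple reflections whose product is `w`. -/
noncomputable def coxeterLength {n : ℕ} (w : Equiv.Perm (Fin n)) : ℕ :=
  sInf {l | ∃ u : List (Fin (n - 1)), wordProd u = w ∧ u.length = l}

/-- `u` is a reduced word of `w`. -/
def IsReducedWord {n : ℕ} (w : Equiv.Perm (Fin n)) (u : List (Fin (n - 1))) : Prop :=
  wordProd u = w ∧ u.length = coxeterLength w

/-- `v` is obtained from `u` by one commutation move: two adjacent letters `i`, `j` with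
`|i - j| > 1` are interchanged. -/
def CommutationMove {m : ℕ} (u v : List (Fin m)) : Prop :=
  ∃ (a b : List (Fin m)) (i j : Fin m), 1 < |((i : ℕ) : ℤ) - ((j : ℕ) : ℤ)| ∧
    u = a ++ i :: j :: b ∧ v = a ++ j :: i :: b

/-- `w` is fully commutative: its reduced words form a single commutation class. -/
def IsFullyCommutative {n : ℕ} (w : Equiv.Perm (Fin n)) : Prop :=
  ∀ u v : List (Fin (n - 1)), IsReducedWord w u → IsReducedWord w v →
    Relation.ReflTransGen CommutationMove u v

/-- The right weak order on `S_n`: the reflexive and transitive closure of the relations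
`v < v s_i` with `ℓ(v) < ℓ(v s_i)`. -/
def RightWeakLE {n : ℕ} : Equiv.Perm (Fin n) → Equiv.Perm (Fin n) → Prop :=
  Relation.ReflTransGen fun v w =>
    ∃ i : Fin (n - 1), w = v * simpleReflection i ∧ coxeterLength v < coxeterLength w

/-! ### The insertion tableau -/

/-- Row insertion of `x` into an increasing row: `x` replaces the leftmost entry larger than `x`,
which is returned as the bumped entry; if there is none, `x` is appended. -/
def rowInsert (x : ℕ) : List ℕ → List ℕ × Option ℕ
  | [] => ([x], none)
  | y :: ys => if x < y then (x :: ys, some y)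
      else (y :: (rowInsert x ys).1, (rowInsert x ys).2)

/-- Insertion of `x` into a tableau, given as the list of its rows: `x` is inserted into the
first row, and an entry that is bumped from a row is inserted into the next one. -/
def tableauInsert (x : ℕ) : List (List ℕ) → List (List ℕ)
  | [] => [[x]]
  | r :: rs => match rowInsert x r with
    | (r₁, none) => r₁ :: rs
    | (r₁, some y) => r₁ :: tableauInsert y rs

/-- The insertion tableau of `w` under the Robinson–Schensted–Knuth algorithm. -/
def insertionTableau {n : ℕ} (w : Equiv.Perm (Fin n)) : List (List ℕ) :=
  (oneLine w).foldl (fun T x => tableauInsert x T) []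

/-- The set of entries in the second row of a tableau (empty if there is no second row). -/
def rowTwo (T : List (List ℕ)) : Set ℤ :=
  {z | ∃ a ∈ T.getD 1 [], z = (a : ℤ)}

/-! ### Crowded sets and crowded permutations -/

/-- A set `L` of integers is uncrowded if `|[y, y + 2x] ∩ L| ≤ x + 1` for all integers `x`, `y`
with `x > 0`. -/
def IsUncrowded (L : Set ℤ) : Prop :=
  ∀ x y : ℤ, 0 < x → ((Set.Icc y (y + 2 * x) ∩ L).ncard : ℤ) ≤ x + 1

/-- A set of integers is crowded if it is not uncrowded. -/
def IsCrowded (L : Set ℤ) : Prop := ¬ IsUncrowded L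

/-- The set of fully commutative permutations in `S_n` whose insertion tableau is crowded, that
is, has a crowded second row. -/
def crowdedFC (n : ℕ) : Set (Equiv.Perm (Fin n)) :=
  {w | IsFullyCommutative w ∧ IsCrowded (rowTwo (insertionTableau w))}

/-- `w` is a minimal element, in the right weak order, of the set of crowded fully commutative
permutations in `S_n`. -/
def IsMinimalCrowded {n : ℕ} (w : Equiv.Perm (Fin n)) : Prop :=
  w ∈ crowdedFC n ∧ ∀ v ∈ crowdedFC n, RightWeakLE v w → v = w

/-! ### Descents and patterns -/

/-- The set of descents of `w`: those `i ∈ {1, …, n - 1}` with `w(i) > w(i + 1)`. -/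
def descents {n : ℕ} (w : Equiv.Perm (Fin n)) : Set ℕ :=
  {i | 1 ≤ i ∧ i < n ∧ letter w (i + 1) < letter w i}

/-- Two sequences of the same length are in the same relative order. -/
def SameRelativeOrder {m : ℕ} (a b : Fin m → ℕ) : Prop :=
  ∀ i j : Fin m, a i < a j ↔ b i < b j

/-- The positions `f(0) < f(1) < ⋯` in `{1, …, n}` carry an occurrence in `w` of the pattern with
one-line notation `p`. -/
def IsOccurrence {m n : ℕ} (p : Fin m → ℕ) (w : Equiv.Perm (Fin n)) (f : Fin m → ℕ) : Prop :=
  StrictMono f ∧ (∀ j, 1 ≤ f j ∧ f j ≤ n) ∧ SameRelativeOrder (fun j => letter w (f j)) p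

/-- A sequence of positions is consecutive if each is one more than its predecessor. -/
def IsConsecutive {m : ℕ} (f : Fin m → ℕ) : Prop :=
  ∀ i j : Fin m, (j : ℕ) = (i : ℕ) + 1 → f j = f i + 1

end FCPerm

namespace FCPerm

/-! ### The one-line notation as a bijection of `ℕ` -/

section Letter

variable {n : ℕ}

/-! Full commutativity is 321-avoidance. For such words the letters bumped from the first row
increase (`lt_of_bump`), so none is ever bumped again, and the second row of the tableau is the set
of all bumped letters. Crowdedness thus depends only on the first row's history
(`mem_crowdedFC_iff`).

Necessity. Undoing a descent of a minimal `w` keeps 321-avoidance, so it must destroy crowdedness.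
If the swap is a Knuth relation, it leaves the rows unchanged, which is impossible. Hence the first
row before a descent lies below the descent bottom (`row_lt`), and the letter after a descent
exceeds its top (`lt_third`). The bumped letters are then exactly the descent tops. A descent whose
top is below everything to the right of the descent loses at most this top when undone; a counting
argument (`exists_lt_top`) shows that only the last descent is like this. The descents therefore
form one interlocking chain, `IsBlock`.

In a block, the `i`-th top equals `d + 2i + m`, where `m` counts the bottoms below it: the letter
`w(p)` is the number of smaller letters, and tops are left-to-right maxima. Here `m ≥ 2` for every
top but the last. A window of three descents is a 415263 when `m ≥ 3` and a 315264 when `m = 2`. If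
`m ≤ 2` always, the tops are uncrowded; if some `m ≥ 4`, they remain crowded without the last top,
against minimality. So `m ≤ 3`, which says that occurrences of 415263 are consecutive, and the value
3 is attained.

Sufficiency. The conditions rebuild a block with `m ≤ 3`. A crowded `v ≤ w` has only tops of `w` as
bumped letters, and must bump the last one. Going down the chain, each bottom must bump its own top
in `v` (`exists_bump_of_le`). So no descent of `w` has been undone, and `v = w`. -/

lemma letter_of_mem (w : Equiv.Perm (Fin n)) {i : ℕ} (h : 1 ≤ i ∧ i ≤ n) :
    letter w i = (w ⟨i - 1, by omega⟩ : ℕ) + 1 := by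
  simp only [letter, dif_pos h]

lemma letter_of_not_mem (w : Equiv.Perm (Fin n)) {i : ℕ} (h : ¬ (1 ≤ i ∧ i ≤ n)) :
    letter w i = i := by
  simp only [letter, dif_neg h]

lemma letter_mem (w : Equiv.Perm (Fin n)) {i : ℕ} (h : 1 ≤ i ∧ i ≤ n) :
    1 ≤ letter w i ∧ letter w i ≤ n := by
  rw [letter_of_mem w h]
  have := (w ⟨i - 1, by omega⟩).isLt
  omega

lemma letter_mul (v w : Equiv.Perm (Fin n)) (i : ℕ) :
    letter (v * w) i = letter v (letter w i) := by
  by_cases h : 1 ≤ i ∧ i ≤ n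
  · rw [letter_of_mem v (letter_mem w h), letter_of_mem _ h]
    simp [letter_of_mem w h]
  · rw [letter_of_not_mem w h, letter_of_not_mem _ h, letter_of_not_mem v h]

lemma letter_one (i : ℕ) : letter (1 : Equiv.Perm (Fin n)) i = i := by
  by_cases h : 1 ≤ i ∧ i ≤ n
  · rw [letter_of_mem _ h]; simp; omega
  · rw [letter_of_not_mem _ h]

@[simp] lemma letter_inv_letter (w : Equiv.Perm (Fin n)) (i : ℕ) :
    letter w⁻¹ (letter w i) = i := by
  rw [← letter_mul, inv_mul_cancel, letter_one]

@[simp] lemma letter_letter_inv (w : Equiv.Perm (Fin n)) (i : ℕ) :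
    letter w (letter w⁻¹ i) = i := by
  rw [← letter_mul, mul_inv_cancel, letter_one]

lemma letter_injective (w : Equiv.Perm (Fin n)) : Function.Injective (letter w) :=
  Function.LeftInverse.injective (letter_inv_letter w)

lemma letter_surjective (w : Equiv.Perm (Fin n)) : Function.Surjective (letter w) :=
  Function.RightInverse.surjective (letter_letter_inv w)

lemma eq_of_letter_eq {v w : Equiv.Perm (Fin n)} (h : ∀ i, letter v i = letter w i) : v = w := by
  ext i
  have := h (i + 1)
  have hi := i.isLt
  rw [letter_of_mem v (by omega), letter_of_mem w (by omega)] at this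
  simpa using this

lemma letter_simpleReflection (i : Fin (n - 1)) (p : ℕ) :
    letter (simpleReflection i) p = Equiv.swap ((i : ℕ) + 1) (i + 2) p := by
  have hi := i.isLt
  by_cases h : 1 ≤ p ∧ p ≤ n
  · rw [letter_of_mem _ h, simpleReflection, Equiv.swap_apply_def, Equiv.swap_apply_def]
    simp only [Fin.ext_iff]
    split_ifs <;> simp <;> omega
  · rw [letter_of_not_mem _ h, Equiv.swap_apply_of_ne_of_ne] <;> omega

lemma letter_mul_simpleReflection (w : Equiv.Perm (Fin n)) (i : Fin (n - 1)) (p : ℕ) :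
    letter (w * simpleReflection i) p = letter w (Equiv.swap ((i : ℕ) + 1) (i + 2) p) := by
  rw [letter_mul, letter_simpleReflection]

lemma simpleReflection_mul_self (i : Fin (n - 1)) :
    simpleReflection i * simpleReflection i = 1 := by
  simp [simpleReflection]

lemma mul_simpleReflection_cancel (w : Equiv.Perm (Fin n)) (i : Fin (n - 1)) :
    w * simpleReflection i * simpleReflection i = w := by
  rw [mul_assoc, simpleReflection_mul_self, mul_one]

lemma simpleReflection_inv (i : Fin (n - 1)) :
    (simpleReflection i)⁻¹ = simpleReflection i := by
  simp [simpleReflection]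

/-- A descent of the one-line notation lies strictly between `0` and `n`. -/
lemma mem_of_descent (w : Equiv.Perm (Fin n)) {p : ℕ} (h : letter w (p + 1) < letter w p) :
    1 ≤ p ∧ p < n := by
  by_cases h1 : 1 ≤ p ∧ p ≤ n
  · refine ⟨h1.1, lt_of_not_ge fun h2 => ?_⟩
    rw [letter_of_not_mem w (i := p + 1) (by omega)] at h
    have := letter_mem w h1
    omega
  · rw [letter_of_not_mem w h1] at h
    by_cases h2 : 1 ≤ p + 1 ∧ p + 1 ≤ n
    · have := letter_mem w h2
      omega
    · rw [letter_of_not_mem w h2] at h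
      omega

end Letter

/-! ### Inversions and the Coxeter length -/

section Inversions

variable {n : ℕ}

/-- `(a, b)` is an inversion of `w`, in terms of letters: `a > b` and `a` precedes `b`. -/
def Inv (w : Equiv.Perm (Fin n)) (a b : ℕ) : Prop :=
  b < a ∧ letter w⁻¹ a < letter w⁻¹ b

lemma inv_letter_iff (w : Equiv.Perm (Fin n)) (p q : ℕ) :
    Inv w (letter w p) (letter w q) ↔ letter w q < letter w p ∧ p < q := by
  simp [Inv]

lemma swap_lt_swap_iff {i p q : ℕ} (h1 : ¬ (p = i ∧ q = i + 1)) (h2 : ¬ (p = i + 1 ∧ q = i)) :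
    Equiv.swap i (i + 1) p < Equiv.swap i (i + 1) q ↔ p < q := by
  simp only [Equiv.swap_apply_def]
  split_ifs <;> omega

lemma letter_inv_mul_simpleReflection (w : Equiv.Perm (Fin n)) (i : Fin (n - 1)) (a : ℕ) :
    letter (w * simpleReflection i)⁻¹ a = Equiv.swap ((i : ℕ) + 1) (i + 2) (letter w⁻¹ a) := by
  rw [mul_inv_rev, simpleReflection_inv, letter_mul, letter_simpleReflection]

/-- Inversions are recorded by letters, not positions, so that multiplication on the right at an
ascent only adds the pair of swapped letters. -/
lemma inv_mul_simpleReflection_iff (w : Equiv.Perm (Fin n)) (i : Fin (n - 1))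
    (h : letter w (i + 1) < letter w (i + 2)) (a b : ℕ) :
    Inv (w * simpleReflection i) a b ↔
      (a = letter w (i + 2) ∧ b = letter w (i + 1)) ∨ Inv w a b := by
  obtain ⟨p, rfl⟩ := letter_surjective w a
  obtain ⟨q, rfl⟩ := letter_surjective w b
  simp only [Inv, letter_inv_mul_simpleReflection, letter_inv_letter,
    (letter_injective w).eq_iff]
  by_cases h1 : p = (i : ℕ) + 1 ∧ q = (i : ℕ) + 2
  · obtain ⟨rfl, rfl⟩ := h1
    simp only [Equiv.swap_apply_left, Equiv.swap_apply_right]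
    omega
  by_cases h2 : p = (i : ℕ) + 2 ∧ q = (i : ℕ) + 1
  · obtain ⟨rfl, rfl⟩ := h2
    simp [h]
  rw [swap_lt_swap_iff h1 h2]
  tauto

lemma inv_bounds (w : Equiv.Perm (Fin n)) {a b : ℕ} (h : Inv w a b) : a ≤ n ∧ b ≤ n := by
  obtain ⟨h1, h2⟩ := h
  by_contra h3
  by_cases hb : 1 ≤ b ∧ b ≤ n
  · have ha : ¬ (1 ≤ a ∧ a ≤ n) := by omega
    have := letter_mem w⁻¹ hb
    rw [letter_of_not_mem _ ha] at h2
    omega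
  · rw [letter_of_not_mem _ hb] at h2
    by_cases ha : 1 ≤ a ∧ a ≤ n
    · have := letter_mem w⁻¹ ha
      omega
    · rw [letter_of_not_mem _ ha] at h2
      omega

open Classical in
/-- The set of inversions of `w`. -/
noncomputable def invFinset (w : Equiv.Perm (Fin n)) : Finset (ℕ × ℕ) :=
  (Finset.range (n + 1) ×ˢ Finset.range (n + 1)).filter fun x => Inv w x.1 x.2

lemma mem_invFinset (w : Equiv.Perm (Fin n)) (x : ℕ × ℕ) :
    x ∈ invFinset w ↔ Inv w x.1 x.2 := by
  simp only [invFinset, Finset.mem_filter, Finset.mem_product, Finset.mem_range,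
    and_iff_right_iff_imp]
  intro h
  have := inv_bounds w h
  omega

lemma card_invFinset_of_ascent (w : Equiv.Perm (Fin n)) (i : Fin (n - 1))
    (h : letter w (i + 1) < letter w (i + 2)) :
    (invFinset (w * simpleReflection i)).card = (invFinset w).card + 1 := by
  have : invFinset (w * simpleReflection i) =
      insert (letter w (i + 2), letter w (i + 1)) (invFinset w) := by
    ext ⟨a, b⟩
    rw [Finset.mem_insert, mem_invFinset, mem_invFinset, inv_mul_simpleReflection_iff w i h,
      Prod.mk.injEq]
  rw [this, Finset.card_insert_of_notMem]
  rw [mem_invFinset, inv_letter_iff]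
  omega

lemma letter_mul_simpleReflection_left (w : Equiv.Perm (Fin n)) (i : Fin (n - 1)) :
    letter (w * simpleReflection i) (i + 1) = letter w (i + 2) := by
  rw [letter_mul_simpleReflection, Equiv.swap_apply_left]

lemma letter_mul_simpleReflection_right (w : Equiv.Perm (Fin n)) (i : Fin (n - 1)) :
    letter (w * simpleReflection i) (i + 2) = letter w (i + 1) := by
  rw [letter_mul_simpleReflection, Equiv.swap_apply_right]

lemma card_invFinset_of_descent (w : Equiv.Perm (Fin n)) (i : Fin (n - 1))
    (h : letter w (i + 2) < letter w (i + 1)) :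
    (invFinset w).card = (invFinset (w * simpleReflection i)).card + 1 := by
  have := card_invFinset_of_ascent (w * simpleReflection i) i
    (by rwa [letter_mul_simpleReflection_left, letter_mul_simpleReflection_right])
  rwa [mul_simpleReflection_cancel] at this

lemma ascent_or_descent (w : Equiv.Perm (Fin n)) (i : Fin (n - 1)) :
    letter w (i + 1) < letter w (i + 2) ∨ letter w (i + 2) < letter w (i + 1) := by
  have : letter w (i + 1) ≠ letter w (i + 2) := fun h => by
    have := letter_injective w h
    omega
  omega

lemma wordProd_concat (u : List (Fin (n - 1))) (i : Fin (n - 1)) :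
    wordProd (n := n) (u ++ [i]) = wordProd u * simpleReflection i := by
  simp [wordProd]

lemma card_invFinset_wordProd_le (u : List (Fin (n - 1))) :
    (invFinset (wordProd (n := n) u)).card ≤ u.length := by
  induction u using List.reverseRecOn with
  | nil =>
    have : invFinset (1 : Equiv.Perm (Fin n)) = ∅ := by
      ext x
      simp only [mem_invFinset, Inv, inv_one, letter_one, Finset.notMem_empty, iff_false]
      omega
    simp [wordProd, this]
  | append_singleton u i ih =>
    rw [wordProd_concat, List.length_append, List.length_singleton]
    rcases ascent_or_descent (wordProd u) i with h | h
    · rw [card_invFinset_of_ascent _ _ h]; omega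
    · have := card_invFinset_of_descent _ _ h; omega

lemma exists_descent (w : Equiv.Perm (Fin n)) (h : w ≠ 1) :
    ∃ p, letter w (p + 1) < letter w p := by
  by_contra! hw
  refine h (eq_of_letter_eq fun i => ?_)
  rw [letter_one]
  -- A strictly increasing self-map of `ℕ` dominates the identity; applied to `w` and to its inverse
  -- this forces equality.
  have mono : StrictMono (letter w) := strictMono_nat_of_lt_succ fun p =>
    lt_of_le_of_ne (hw p) ((letter_injective w).ne (by omega))
  have mono' : StrictMono (letter w⁻¹) := fun a b hab => by
    rw [← mono.lt_iff_lt]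
    simpa using hab
  have h1 := mono.le_apply (x := i)
  have h2 := mono'.le_apply (x := letter w i)
  rw [letter_inv_letter] at h2
  omega

/-- The simple reflection at a descent. -/
lemma exists_fin_of_descent (w : Equiv.Perm (Fin n)) {p : ℕ} (h : letter w (p + 1) < letter w p) :
    ∃ i : Fin (n - 1), (i : ℕ) + 1 = p := by
  have := mem_of_descent w h
  exact ⟨⟨p - 1, by omega⟩, by simp; omega⟩

/-- Bubble sort: undoing descents one at a time removes one inversion per step. -/
lemma exists_word (w : Equiv.Perm (Fin n)) :
    ∃ u : List (Fin (n - 1)), wordProd u = w ∧ u.length = (invFinset w).card := by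
  induction hN : (invFinset w).card generalizing w with
  | zero =>
    refine ⟨[], ?_, rfl⟩
    by_contra hw
    obtain ⟨p, hp⟩ := exists_descent w (fun h => hw (by rw [h]; simp [wordProd]))
    rw [Finset.card_eq_zero] at hN
    have : (letter w p, letter w (p + 1)) ∈ invFinset w := by
      rw [mem_invFinset, inv_letter_iff]
      omega
    simp [hN] at this
  | succ N ih =>
    have hw : w ≠ 1 := by
      rintro rfl
      have := card_invFinset_wordProd_le (n := n) []
      simp [wordProd] at this
      simp [this] at hN
    obtain ⟨p, hp⟩ := exists_descent w hw
    obtain ⟨i, rfl⟩ := exists_fin_of_descent w hp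
    have := card_invFinset_of_descent w i hp
    obtain ⟨u, hu, hl⟩ := ih (w * simpleReflection i) (by omega)
    exact ⟨u ++ [i], by rw [wordProd_concat, hu, mul_simpleReflection_cancel], by simp [hl]⟩

theorem coxeterLength_eq_card (w : Equiv.Perm (Fin n)) :
    coxeterLength w = (invFinset w).card := by
  apply le_antisymm
  · obtain ⟨u, hu, hl⟩ := exists_word w
    exact Nat.sInf_le ⟨u, hu, hl⟩
  · obtain ⟨u, hu, hl⟩ := exists_word w
    refine le_csInf ⟨_, u, hu, hl⟩ ?_
    rintro _ ⟨v, rfl, rfl⟩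
    exact card_invFinset_wordProd_le v

lemma exists_reducedWord (w : Equiv.Perm (Fin n)) : ∃ u, IsReducedWord w u := by
  obtain ⟨u, hu, hl⟩ := exists_word w
  exact ⟨u, hu, hl.trans (coxeterLength_eq_card w).symm⟩

lemma coxeterLength_lt_mul_iff (w : Equiv.Perm (Fin n)) (i : Fin (n - 1)) :
    coxeterLength w < coxeterLength (w * simpleReflection i) ↔
      letter w (i + 1) < letter w (i + 2) := by
  rw [coxeterLength_eq_card, coxeterLength_eq_card]
  rcases ascent_or_descent w i with h | h
  · have := card_invFinset_of_ascent _ _ h; omega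
  · have := card_invFinset_of_descent _ _ h; omega

/-- The letters that a reduced word may end with are the descents. -/
lemma isReducedWord_concat_iff (w : Equiv.Perm (Fin n)) (u : List (Fin (n - 1)))
    (i : Fin (n - 1)) :
    IsReducedWord w (u ++ [i]) ↔
      letter w (i + 2) < letter w (i + 1) ∧ IsReducedWord (w * simpleReflection i) u := by
  simp only [IsReducedWord, wordProd_concat, coxeterLength_eq_card, List.length_append,
    List.length_singleton]
  constructor
  · rintro ⟨rfl, hl⟩
    have hu := card_invFinset_wordProd_le (n := n) u
    have hd : letter (wordProd u) (i + 1) < letter (wordProd (n := n) u) (i + 2) := by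
      refine (ascent_or_descent (wordProd u) i).resolve_right fun h => ?_
      have := card_invFinset_of_descent _ _ h
      omega
    have := card_invFinset_of_ascent _ _ hd
    rw [letter_mul_simpleReflection_left, letter_mul_simpleReflection_right,
      mul_simpleReflection_cancel]
    exact ⟨hd, rfl, by omega⟩
  · rintro ⟨hd, hu, hl⟩
    have := card_invFinset_of_descent _ _ hd
    exact ⟨by rw [hu, mul_simpleReflection_cancel], by omega⟩

lemma RightWeakLE.inv {v w : Equiv.Perm (Fin n)} (h : RightWeakLE v w) {a b : ℕ}
    (hv : Inv v a b) : Inv w a b := by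
  induction h with
  | refl => exact hv
  | tail _ h ih =>
    obtain ⟨i, rfl, hl⟩ := h
    rw [coxeterLength_lt_mul_iff] at hl
    exact (inv_mul_simpleReflection_iff _ i hl a b).2 (Or.inr ih)

/-- Below `w` in the weak order, some descent of `w` has been undone. -/
lemma RightWeakLE.exists_descent_not_inv {v w : Equiv.Perm (Fin n)} (h : RightWeakLE v w)
    (hne : v ≠ w) :
    ∃ p, letter w (p + 1) < letter w p ∧ ¬ Inv v (letter w p) (letter w (p + 1)) := by
  rcases Relation.ReflTransGen.cases_tail h with h | ⟨u, hvu, i, rfl, hl⟩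
  · exact absurd h.symm hne
  · rw [coxeterLength_lt_mul_iff] at hl
    refine ⟨i + 1, ?_, fun hv => ?_⟩
    · rwa [letter_mul_simpleReflection_left, letter_mul_simpleReflection_right]
    · have := RightWeakLE.inv hvu hv
      rw [letter_mul_simpleReflection_left, letter_mul_simpleReflection_right,
        inv_letter_iff] at this
      omega

lemma rightWeakLE_of_descent (w : Equiv.Perm (Fin n)) (i : Fin (n - 1))
    (h : letter w (i + 2) < letter w (i + 1)) : RightWeakLE (w * simpleReflection i) w := by
  refine Relation.ReflTransGen.single ⟨i, (mul_simpleReflection_cancel w i).symm, ?_⟩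
  have := coxeterLength_lt_mul_iff (w * simpleReflection i) i
  rw [mul_simpleReflection_cancel] at this
  rwa [this, letter_mul_simpleReflection_left, letter_mul_simpleReflection_right]

end Inversions

/-! ### Full commutativity and the pattern `321` -/

section FullyCommutative

variable {n : ℕ}

/-- The sequence `f` has no decreasing subsequence of length three. -/
def Avoids321 (f : ℕ → ℕ) : Prop :=
  ∀ p q r, p < q → q < r → f q < f p → f r < f q → False

/-- In terms of inversions, avoidance visibly passes to anything lower in the weak order. -/
lemma avoids321_iff_inv (w : Equiv.Perm (Fin n)) :
    Avoids321 (letter w) ↔ ∀ a b c, Inv w a b → Inv w b c → False := by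
  constructor
  · intro h a b c h1 h2
    exact h _ _ _ h1.2 h2.2 (by simpa using h1.1) (by simpa using h2.1)
  · intro h p q r h1 h2 h3 h4
    exact h _ _ _ ((inv_letter_iff w p q).2 ⟨h3, h1⟩) ((inv_letter_iff w q r).2 ⟨h4, h2⟩)

lemma Avoids321.of_rightWeakLE {v w : Equiv.Perm (Fin n)} (hw : Avoids321 (letter w))
    (h : RightWeakLE v w) : Avoids321 (letter v) := by
  rw [avoids321_iff_inv] at hw ⊢
  exact fun a b c h1 h2 => hw a b c (h.inv h1) (h.inv h2)

lemma CommutationMove.append_right {m : ℕ} {u v : List (Fin m)} (h : CommutationMove u v)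
    (x : List (Fin m)) : CommutationMove (u ++ x) (v ++ x) := by
  obtain ⟨a, b, i, j, hij, rfl, rfl⟩ := h
  exact ⟨a, b ++ x, i, j, hij, by simp, by simp⟩

lemma CommutationMove.perm {m : ℕ} {u v : List (Fin m)} (h : CommutationMove u v) :
    u.Perm v := by
  obtain ⟨a, b, i, j, hij, rfl, rfl⟩ := h
  exact List.Perm.append_left _ (List.Perm.swap _ _ _)

lemma reflTransGen_append_right {m : ℕ} {u v : List (Fin m)}
    (h : Relation.ReflTransGen CommutationMove u v) (x : List (Fin m)) :
    Relation.ReflTransGen CommutationMove (u ++ x) (v ++ x) :=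
  h.lift (· ++ x) fun _ _ h => CommutationMove.append_right h x

/-- Two different last letters of reduced words are both descents; without a 321 they are not
adjacent, so they commute. A word `x` of what remains after undoing both links the two given words
by induction. -/
theorem isFullyCommutative_of_avoids321 (w : Equiv.Perm (Fin n)) (hw : Avoids321 (letter w)) :
    IsFullyCommutative w := by
  intro u v hu hv
  induction hN : u.length generalizing w u v with
  | zero =>
    have hl : v.length = 0 := by rw [hv.2, ← hu.2, hN]
    rw [List.length_eq_zero_iff] at hN hl
    rw [hN, hl]
  | succ N ih =>
    have hl : v.length = N + 1 := by rw [hv.2, ← hu.2, hN]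
    rcases List.eq_nil_or_concat' u with rfl | ⟨u, i, rfl⟩
    · simp at hN
    rcases List.eq_nil_or_concat' v with rfl | ⟨v, j, rfl⟩
    · simp at hl
    simp only [List.length_append, List.length_singleton, Nat.add_right_cancel_iff] at hN hl
    rw [isReducedWord_concat_iff] at hu hv
    have hwi := hw.of_rightWeakLE (rightWeakLE_of_descent w i hu.1)
    have hwj := hw.of_rightWeakLE (rightWeakLE_of_descent w j hv.1)
    by_cases hij : i = j
    · subst hij
      exact reflTransGen_append_right (ih _ hwi u v hu.2 hv.2 hN) _
    have hne : (i : ℕ) ≠ j := fun h => hij (Fin.ext h)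
    have h1 : (i : ℕ) + 1 ≠ j := fun h =>
      hw (i + 1) (i + 2) (i + 3) (by omega) (by omega) hu.1 (by have := hv.1; rwa [← h] at this)
    have h2 : (j : ℕ) + 1 ≠ i := fun h =>
      hw (j + 1) (j + 2) (j + 3) (by omega) (by omega) hv.1 (by have := hu.1; rwa [← h] at this)
    have hcomm : w * simpleReflection i * simpleReflection j =
        w * simpleReflection j * simpleReflection i := by
      refine eq_of_letter_eq fun p => ?_
      simp only [letter_mul_simpleReflection]
      congr 1
      simp only [Equiv.swap_apply_def]
      split_ifs <;> omega
    obtain ⟨x, hx⟩ := exists_reducedWord (w * simpleReflection i * simpleReflection j)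
    have hxj : IsReducedWord (w * simpleReflection i) (x ++ [j]) := by
      rw [isReducedWord_concat_iff]
      refine ⟨?_, hx⟩
      rw [letter_mul_simpleReflection, letter_mul_simpleReflection,
        Equiv.swap_apply_of_ne_of_ne, Equiv.swap_apply_of_ne_of_ne]
      · exact hv.1
      all_goals omega
    have hxi : IsReducedWord (w * simpleReflection j) (x ++ [i]) := by
      rw [isReducedWord_concat_iff]
      refine ⟨?_, hcomm ▸ hx⟩
      rw [letter_mul_simpleReflection, letter_mul_simpleReflection,
        Equiv.swap_apply_of_ne_of_ne, Equiv.swap_apply_of_ne_of_ne]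
      · exact hu.1
      all_goals omega
    have hlx : (x ++ [i]).length = N := by rw [hxi.2, ← hv.2.2, hl]
    have e1 := reflTransGen_append_right (ih _ hwi u _ hu.2 hxj hN) [i]
    have e2 := reflTransGen_append_right (ih _ hwj _ v hxi hv.2 hlx) [j]
    refine (e1.tail ⟨x, [], j, i, ?_, by simp, rfl⟩).trans (by simpa using e2)
    rw [lt_abs]
    omega

lemma swap_braid {α : Type*} [DecidableEq α] {a b c : α} (hab : a ≠ b) (hac : a ≠ c)
    (hcb : c ≠ b) : Equiv.swap a b * Equiv.swap b c * Equiv.swap a b =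
      Equiv.swap b c * Equiv.swap a b * Equiv.swap b c := by
  rw [Equiv.swap_mul_swap_mul_swap hab hac, Equiv.swap_comm a b, Equiv.swap_comm b c,
    Equiv.swap_mul_swap_mul_swap hcb hac.symm, Equiv.swap_comm]

/-- A permutation containing `321` has a reduced word with a factor `i (i+1) i`. -/
lemma exists_braid_of_pattern (w : Equiv.Perm (Fin n)) (p q r : ℕ) (hpq : p < q) (hqr : q < r)
    (h1 : letter w q < letter w p) (h2 : letter w r < letter w q) :
    ∃ (x y : List (Fin (n - 1))) (i j : Fin (n - 1)), (i : ℕ) + 1 = j ∧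
      IsReducedWord w (x ++ [i, j, i] ++ y) ∧ IsReducedWord w (x ++ [j, i, j] ++ y) := by
  -- The measure drops either by undoing a descent while some 321 survives, with its letter appended
  -- to both words, or by narrowing the pattern until it is consecutive.
  induction hN : (invFinset w).card + (r - p) using Nat.strong_induction_on
    generalizing w p q r with
  | _ N ih =>
  have step : ∀ (i : Fin (n - 1)) (p' q' r' : ℕ), letter w (i + 2) < letter w (i + 1) →
      p' < q' → q' < r' → r' - p' ≤ r - p →
      letter (w * simpleReflection i) q' < letter (w * simpleReflection i) p' →
      letter (w * simpleReflection i) r' < letter (w * simpleReflection i) q' →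
      ∃ (x y : List (Fin (n - 1))) (i j : Fin (n - 1)), (i : ℕ) + 1 = j ∧
      IsReducedWord w (x ++ [i, j, i] ++ y) ∧ IsReducedWord w (x ++ [j, i, j] ++ y) := by
    intro i p' q' r' hd hpq' hqr' hle h1' h2'
    have hc := card_invFinset_of_descent w i hd
    obtain ⟨x, y, k, l, hkl, e1, e2⟩ := ih _ (by omega) (w * simpleReflection i) p' q' r'
      hpq' hqr' h1' h2' rfl
    refine ⟨x, y ++ [i], k, l, hkl, ?_, ?_⟩
    · rw [← List.append_assoc, isReducedWord_concat_iff]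
      exact ⟨hd, e1⟩
    · rw [← List.append_assoc, isReducedWord_concat_iff]
      exact ⟨hd, e2⟩
  by_cases hp : p + 1 < q
  · rcases lt_or_ge (letter w (p + 1)) (letter w p) with h | h
    · obtain ⟨i, rfl⟩ := exists_fin_of_descent w h
      refine step i (i + 2) q r h (by omega) hqr (by omega) ?_ ?_
      · rw [letter_mul_simpleReflection_right, letter_mul_simpleReflection,
          Equiv.swap_apply_of_ne_of_ne] <;> omega
      · rw [letter_mul_simpleReflection, letter_mul_simpleReflection,
          Equiv.swap_apply_of_ne_of_ne, Equiv.swap_apply_of_ne_of_ne] <;> omega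
    · exact ih _ (by omega) w (p + 1) q r hp hqr (by omega) h2 rfl
  by_cases hq : q + 1 < r
  · obtain ⟨r, rfl⟩ : ∃ r', r = r' + 1 := ⟨r - 1, by omega⟩
    rcases lt_or_ge (letter w (r + 1)) (letter w r) with h | h
    · obtain ⟨i, rfl⟩ := exists_fin_of_descent w h
      refine step i p q (i + 1) h hpq (by omega) (by omega) ?_ ?_
      · rw [letter_mul_simpleReflection, letter_mul_simpleReflection,
          Equiv.swap_apply_of_ne_of_ne, Equiv.swap_apply_of_ne_of_ne] <;> omega
      · rw [letter_mul_simpleReflection_left, letter_mul_simpleReflection,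
          Equiv.swap_apply_of_ne_of_ne] <;> omega
    · have hne : letter w r ≠ letter w (r + 1) := (letter_injective w).ne (by omega)
      exact ih _ (by omega) w p q r hpq (by omega) h1 (by omega) rfl
  obtain rfl : q = p + 1 := by omega
  obtain rfl : r = p + 1 + 1 := by omega
  obtain ⟨i, rfl⟩ := exists_fin_of_descent w h1
  obtain ⟨j, hj⟩ := exists_fin_of_descent w h2
  have hij : (j : ℕ) = i + 1 := by omega
  have braid : w * simpleReflection i * simpleReflection j * simpleReflection i =
      w * simpleReflection j * simpleReflection i * simpleReflection j := by
    have ha : (⟨i, by omega⟩ : Fin n) ≠ ⟨i + 1, by omega⟩ := by simp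
    have hb : (⟨i, by omega⟩ : Fin n) ≠ ⟨i + 1 + 1, by omega⟩ := by simp; omega
    have hc : (⟨i + 1 + 1, by omega⟩ : Fin n) ≠ ⟨i + 1, by omega⟩ := by simp
    simp only [mul_assoc, simpleReflection, hij]
    congr 1
    simpa only [mul_assoc] using swap_braid ha hb hc
  obtain ⟨x, hx⟩ :=
    exists_reducedWord (w * simpleReflection i * simpleReflection j * simpleReflection i)
  have ei : ∀ v : Equiv.Perm (Fin n), letter (v * simpleReflection i) (i + 3) = letter v (i + 3) :=
    fun v => by rw [letter_mul_simpleReflection, Equiv.swap_apply_of_ne_of_ne] <;> omega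
  have ej : ∀ v : Equiv.Perm (Fin n), letter (v * simpleReflection j) (i + 1) = letter v (i + 1) :=
    fun v => by rw [letter_mul_simpleReflection, Equiv.swap_apply_of_ne_of_ne] <;> omega
  have ej1 : ∀ v : Equiv.Perm (Fin n), letter (v * simpleReflection j) (i + 2) = letter v (i + 3) :=
    fun v => by rw [letter_mul_simpleReflection, hij, Equiv.swap_apply_left]
  have ej2 : ∀ v : Equiv.Perm (Fin n), letter (v * simpleReflection j) (i + 3) = letter v (i + 2) :=
    fun v => by rw [letter_mul_simpleReflection, hij, Equiv.swap_apply_right]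
  have h3 : letter w (i + 3) < letter w (i + 1) := h2.trans h1
  have a1 : (j : ℕ) + 1 = i + 2 := by omega
  have a2 : (j : ℕ) + 2 = i + 3 := by omega
  refine ⟨x, [], i, j, by omega, ?_, ?_⟩
  · rw [List.append_nil, show x ++ [i, j, i] = x ++ [i] ++ [j] ++ [i] by simp]
    simp only [isReducedWord_concat_iff, a1, a2]
    refine ⟨h1, ?_, ?_, hx⟩
    · rw [ei, letter_mul_simpleReflection_right]; exact h3
    · rw [ej1, ej, ei, letter_mul_simpleReflection_left]; exact h2
  · rw [List.append_nil, show x ++ [j, i, j] = x ++ [j] ++ [i] ++ [j] by simp]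
    simp only [isReducedWord_concat_iff, a1, a2]
    refine ⟨h2, ?_, ?_, braid ▸ hx⟩
    · rw [ej1, ej]; exact h3
    · rw [ei, letter_mul_simpleReflection_right, ej2, ej]; exact h1

/-- Commutation moves preserve the multiplicity of each letter, whereas the two sides of a braid
relation contain `i` twice and once. -/
theorem avoids321_of_isFullyCommutative (w : Equiv.Perm (Fin n)) (hw : IsFullyCommutative w) :
    Avoids321 (letter w) := by
  intro p q r hpq hqr h1 h2
  obtain ⟨x, y, i, j, hij, e1, e2⟩ := exists_braid_of_pattern w p q r hpq hqr h1 h2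
  have hperm : ∀ u v : List (Fin (n - 1)), Relation.ReflTransGen CommutationMove u v →
      u.Perm v := by
    intro u v h
    induction h with
    | refl => exact List.Perm.refl _
    | tail _ h ih => exact ih.trans h.perm
  have hc := (hperm _ _ (hw _ _ e1 e2)).count_eq i
  have hne : j ≠ i := fun h => by rw [h] at hij; omega
  simp [hne] at hc

end FullyCommutative

end FCPerm

namespace FCPerm

/-! ### The first two rows of the insertion tableau -/

section Rows

open Classical in
/-- One step of row insertion on sets: the least element of the row larger than `x`, if there is
one, moves to the second component, and `x` joins the row. -/
noncomputable def popStep (S : Finset ℕ × Finset ℕ) (x : ℕ) : Finset ℕ × Finset ℕ :=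
  if h : (S.1.filter (x < ·)).Nonempty then
    (insert x (S.1.erase ((S.1.filter (x < ·)).min' h)),
      insert ((S.1.filter (x < ·)).min' h) S.2)
  else (insert x S.1, S.2)

lemma popStep_of_forall_le {S : Finset ℕ × Finset ℕ} {x : ℕ} (h : ∀ y ∈ S.1, y ≤ x) :
    popStep S x = (insert x S.1, S.2) := by
  rw [popStep, dif_neg]
  rintro ⟨y, hy⟩
  rw [Finset.mem_filter] at hy
  have := h y hy.1
  omega

lemma popStep_of_min {S : Finset ℕ × Finset ℕ} {x y : ℕ} (hy : y ∈ S.1) (hxy : x < y)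
    (hmin : ∀ z ∈ S.1, x < z → y ≤ z) :
    popStep S x = (insert x (S.1.erase y), insert y S.2) := by
  have hne : (S.1.filter (x < ·)).Nonempty := ⟨y, Finset.mem_filter.2 ⟨hy, hxy⟩⟩
  have hm : (S.1.filter (x < ·)).min' hne = y := by
    apply le_antisymm
    · exact Finset.min'_le _ _ (Finset.mem_filter.2 ⟨hy, hxy⟩)
    · refine Finset.le_min' _ _ _ fun z hz => ?_
      rw [Finset.mem_filter] at hz
      exact hmin z hz.1 hz.2
  rw [popStep, dif_pos hne, hm]

lemma forall_le_or_exists_min (R : Finset ℕ) (x : ℕ) :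
    (∀ y ∈ R, y ≤ x) ∨ ∃ y ∈ R, x < y ∧ ∀ z ∈ R, x < z → y ≤ z := by
  by_cases h : (R.filter (x < ·)).Nonempty
  · right
    have hm := Finset.min'_mem _ h
    rw [Finset.mem_filter] at hm
    exact ⟨_, hm.1, hm.2, fun z hz hxz => Finset.min'_le _ _ (Finset.mem_filter.2 ⟨hz, hxz⟩)⟩
  · left
    intro y hy
    by_contra hxy
    exact h ⟨y, Finset.mem_filter.2 ⟨hy, by omega⟩⟩

/-- The set of entries of the first row, and the set of entries bumped from it, after the
insertion of `f 1, …, f p`. -/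
noncomputable def rows (f : ℕ → ℕ) : ℕ → Finset ℕ × Finset ℕ
  | 0 => (∅, ∅)
  | p + 1 => popStep (rows f p) (f (p + 1))

lemma rows_zero (f : ℕ → ℕ) : rows f 0 = (∅, ∅) := rfl

lemma rows_succ (f : ℕ → ℕ) (p : ℕ) : rows f (p + 1) = popStep (rows f p) (f (p + 1)) := rfl

lemma rows_succ_cases (f : ℕ → ℕ) (p : ℕ) :
    ((∀ y ∈ (rows f p).1, y ≤ f (p + 1)) ∧
      rows f (p + 1) = (insert (f (p + 1)) (rows f p).1, (rows f p).2)) ∨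
    ∃ y ∈ (rows f p).1, f (p + 1) < y ∧ (∀ z ∈ (rows f p).1, f (p + 1) < z → y ≤ z) ∧
      rows f (p + 1) = (insert (f (p + 1)) ((rows f p).1.erase y), insert y (rows f p).2) := by
  rcases forall_le_or_exists_min (rows f p).1 (f (p + 1)) with h | ⟨y, hy, hxy, hmin⟩
  · exact Or.inl ⟨h, popStep_of_forall_le h⟩
  · exact Or.inr ⟨y, hy, hxy, hmin, popStep_of_min hy hxy hmin⟩

lemma rows_congr {f g : ℕ → ℕ} (p : ℕ) (h : ∀ q, q ≤ p → f q = g q) : rows f p = rows g p := by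
  induction p with
  | zero => rfl
  | succ p ih => rw [rows_succ, rows_succ, ih fun q hq => h q (by omega), h _ le_rfl]

lemma rows_congr_after {f g : ℕ → ℕ} {p m : ℕ} (hp : rows f p = rows g p) (hpm : p ≤ m)
    (h : ∀ q, p < q → f q = g q) : rows f m = rows g m := by
  induction m, hpm using Nat.le_induction with
  | base => exact hp
  | succ m hm ih => rw [rows_succ, rows_succ, ih, h _ (by omega)]

lemma mem_rows (f : ℕ → ℕ) (p y : ℕ) :
    (y ∈ (rows f p).1 ∨ y ∈ (rows f p).2) ↔ ∃ q, 1 ≤ q ∧ q ≤ p ∧ f q = y := by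
  induction p with
  | zero =>
    simp only [rows_zero, Finset.notMem_empty, or_self, false_iff]
    rintro ⟨q, h1, h2, -⟩
    omega
  | succ p ih =>
    have hr : (∃ q, 1 ≤ q ∧ q ≤ p + 1 ∧ f q = y) ↔
        y = f (p + 1) ∨ ∃ q, 1 ≤ q ∧ q ≤ p ∧ f q = y := by
      constructor
      · rintro ⟨q, h1, h2, rfl⟩
        rcases Nat.lt_or_ge p q with h | h
        · left; congr 1; omega
        · exact Or.inr ⟨q, h1, h, rfl⟩
      · rintro (rfl | ⟨q, h1, h2, rfl⟩)
        · exact ⟨p + 1, by omega, le_rfl, rfl⟩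
        · exact ⟨q, h1, by omega, rfl⟩
    rw [hr, ← ih]
    rcases rows_succ_cases f p with ⟨-, h⟩ | ⟨z, hz, -, -, h⟩
    · rw [h]
      simp only [Finset.mem_insert]
      tauto
    · rw [h]
      simp only [Finset.mem_insert, Finset.mem_erase]
      by_cases hyz : y = z
      · subst hyz; tauto
      · tauto

variable {f : ℕ → ℕ}

lemma notMem_rows (hf : Function.Injective f) {p q : ℕ} (h : p < q) :
    f q ∉ (rows f p).1 ∧ f q ∉ (rows f p).2 := by
  rw [← not_or, mem_rows]
  rintro ⟨r, -, hr, he⟩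
  have := hf he
  omega

lemma rows_disjoint (hf : Function.Injective f) {p y : ℕ} (h1 : y ∈ (rows f p).1)
    (h2 : y ∈ (rows f p).2) : False := by
  induction p generalizing y with
  | zero => simp [rows_zero] at h1
  | succ p ih =>
    rcases rows_succ_cases f p with ⟨-, h⟩ | ⟨z, hz, hxz, -, h⟩
    · rw [h, Finset.mem_insert] at h1
      rw [h] at h2
      rcases h1 with rfl | h1
      · exact (notMem_rows hf (Nat.lt_succ_self p)).2 h2
      · exact ih h1 h2
    · rw [h, Finset.mem_insert, Finset.mem_erase] at h1
      rw [h, Finset.mem_insert] at h2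
      rcases h1 with rfl | ⟨h1, h1'⟩
      · rcases h2 with h2 | h2
        · omega
        · exact (notMem_rows hf (Nat.lt_succ_self p)).2 h2
      · exact ih h1' (h2.resolve_left h1)

lemma rows_snd_mono {p m : ℕ} (h : p ≤ m) : (rows f p).2 ⊆ (rows f m).2 := by
  induction m, h using Nat.le_induction with
  | base => exact subset_rfl
  | succ m hm ih =>
    refine ih.trans ?_
    rcases rows_succ_cases f m with ⟨-, h⟩ | ⟨z, -, -, -, h⟩ <;> rw [h]
    exact Finset.subset_insert _ _

/-- Every bumped letter was bumped by some later letter. -/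
lemma exists_bump {m z : ℕ} (hz : z ∈ (rows f m).2) :
    ∃ r, r < m ∧ z ∈ (rows f r).1 ∧ f (r + 1) < z ∧
      (∀ y ∈ (rows f r).1, f (r + 1) < y → z ≤ y) ∧ z ∈ (rows f (r + 1)).2 := by
  induction m with
  | zero => simp [rows_zero] at hz
  | succ m ih =>
    by_cases hzm : z ∈ (rows f m).2
    · obtain ⟨r, hr, h⟩ := ih hzm
      exact ⟨r, by omega, h⟩
    · refine ⟨m, by omega, ?_⟩
      rcases rows_succ_cases f m with ⟨-, h⟩ | ⟨y, hy, hxy, hmin, h⟩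
      · rw [h] at hz
        exact absurd hz hzm
      · have hzy : z = y := by
          rw [h, Finset.mem_insert] at hz
          exact hz.resolve_right hzm
        subst hzy
        exact ⟨hy, hxy, hmin, hz⟩

/-- If `f` avoids `321`, the bumped letters increase. -/
lemma lt_of_bump (hf : Function.Injective f) (h321 : Avoids321 f) {p y z : ℕ}
    (hy : y ∈ (rows f p).1) (hxy : f (p + 1) < y) (hz : z ∈ (rows f p).2) : z < y := by
  by_contra hyz
  have hne : y ≠ z := by
    rintro rfl
    exact rows_disjoint hf hy hz
  obtain ⟨r, hr, hzr, hxz, hmin, -⟩ := exists_bump hz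
  obtain ⟨q, hq1, hq2, rfl⟩ := (mem_rows f r z).1 (Or.inl hzr)
  obtain ⟨t, ht1, ht2, rfl⟩ := (mem_rows f p y).1 (Or.inl hy)
  -- If `y` entered no earlier than the letter that bumped `z`, then `z`, `y`, `f (p + 1)` form a
  -- 321. Otherwise `y` was in the row and was spared, so it is at most that bumping letter, and
  -- `z`, the bumping letter, `f (p + 1)` form a 321.
  rcases Nat.lt_or_ge r t with htr | htr
  · exact h321 q t (p + 1) (by omega) (by omega) (by omega) hxy
  · have hyr : f t ∈ (rows f r).1 := by
      refine ((mem_rows f r (f t)).2 ⟨t, ht1, htr, rfl⟩).resolve_right fun h => ?_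
      exact rows_disjoint hf hy (rows_snd_mono hr.le h)
    have hle : f t ≤ f (r + 1) := by
      by_contra h
      have := hmin _ hyr (by omega)
      omega
    exact h321 q (r + 1) (p + 1) (by omega) (by omega) hxz (by omega)

/-! ### Agreement of list insertion with the set model `rows` -/

lemma rowInsert_of_forall_le {x : ℕ} {r : List ℕ} (h : ∀ y ∈ r, y ≤ x) :
    rowInsert x r = (r ++ [x], none) := by
  induction r with
  | nil => rfl
  | cons a r ih =>
    have ha := h a (by simp)
    rw [rowInsert, if_neg (by omega), ih fun y hy => h y (by simp [hy])]
    rfl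

lemma rowInsert_of_min {x y : ℕ} {r : List ℕ} (hr : r.Pairwise (· < ·)) (hx : x ∉ r)
    (hy : y ∈ r) (hxy : x < y) (hmin : ∀ z ∈ r, x < z → y ≤ z) :
    (rowInsert x r).2 = some y ∧ (rowInsert x r).1.Pairwise (· < ·) ∧
      ∀ z, z ∈ (rowInsert x r).1 ↔ z = x ∨ z ≠ y ∧ z ∈ r := by
  induction r with
  | nil => simp at hy
  | cons a r ih =>
    rw [List.pairwise_cons] at hr
    simp only [List.mem_cons, not_or] at hx
    rw [rowInsert]
    by_cases hxa : x < a
    · rw [if_pos hxa]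
      have hya : y = a := by
        have h1 := hmin a (by simp) hxa
        rcases List.mem_cons.1 hy with h | h
        · exact h
        · have := hr.1 y h
          omega
      subst hya
      refine ⟨rfl, List.pairwise_cons.2 ⟨fun z hz => hxa.trans (hr.1 z hz), hr.2⟩, fun z => ?_⟩
      have : z ∈ r → z ≠ y := fun h => (hr.1 z h).ne'
      simp only [List.mem_cons]
      tauto
    · rw [if_neg hxa]
      have hya : y ≠ a := by omega
      obtain ⟨h1, h2, h3⟩ := ih hr.2 hx.2 ((List.mem_cons.1 hy).resolve_left hya)
        fun z hz => hmin z (by simp [hz])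
      refine ⟨h1, List.pairwise_cons.2 ⟨fun z hz => ?_, h2⟩, fun z => ?_⟩
      · rcases (h3 z).1 hz with rfl | hz
        · omega
        · exact hr.1 z hz.2
      · simp only [List.mem_cons, h3]
        by_cases hza : z = a
        · subst hza
          simp [hya.symm]
        · tauto

lemma tableauInsert_row_one (x : ℕ) (T : List (List ℕ)) :
    (tableauInsert x T).getD 0 [] = (rowInsert x (T.getD 0 [])).1 := by
  cases T with
  | nil => rfl
  | cons r T =>
    rw [tableauInsert]
    rcases h : rowInsert x r with ⟨r', _ | y⟩ <;> simp [h]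

lemma tableauInsert_row_two_of_none {x : ℕ} {T : List (List ℕ)}
    (h : (rowInsert x (T.getD 0 [])).2 = none) :
    (tableauInsert x T).getD 1 [] = T.getD 1 [] := by
  cases T with
  | nil => rfl
  | cons r T =>
    rw [tableauInsert]
    rcases h' : rowInsert x r with ⟨r', _ | y⟩
    · simp
    · simp [h'] at h

lemma tableauInsert_row_two_of_some {x y : ℕ} {T : List (List ℕ)}
    (h : (rowInsert x (T.getD 0 [])).2 = some y) :
    (tableauInsert x T).getD 1 [] = (rowInsert y (T.getD 1 [])).1 := by
  cases T with
  | nil => simp [rowInsert] at h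
  | cons r T =>
    rw [tableauInsert]
    rcases h' : rowInsert x r with ⟨r', _ | z⟩
    · simp [h'] at h
    · have hz : z = y := by simpa [h'] using h
      have := tableauInsert_row_one y T
      simpa [hz] using this

/-- The insertion tableau of `f 1, …, f p`. -/
def tableauOf (f : ℕ → ℕ) (p : ℕ) : List (List ℕ) :=
  ((List.range p).map fun i => f (i + 1)).foldl (fun T x => tableauInsert x T) []

lemma tableauOf_succ (f : ℕ → ℕ) (p : ℕ) :
    tableauOf f (p + 1) = tableauInsert (f (p + 1)) (tableauOf f p) := by
  simp [tableauOf, List.range_succ]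

lemma insertionTableau_eq {n : ℕ} (w : Equiv.Perm (Fin n)) :
    insertionTableau w = tableauOf (letter w) n := by
  have : oneLine w = (List.range n).map fun i => letter w (i + 1) := by
    apply List.ext_getElem
    · simp [oneLine]
    · intro i h1 h2
      have hi : i < n := by simpa [oneLine] using h1
      simp [oneLine, letter_of_mem w (show 1 ≤ i + 1 ∧ i + 1 ≤ n by omega)]
  rw [insertionTableau, this, tableauOf]

/-- By `lt_of_bump` each bumped letter exceeds the whole second row and is appended there, so the
second row only grows. Sortedness of the first row identifies its leftmost larger entry with the
least one. -/
lemma tableauOf_rows (hf : Function.Injective f) (h321 : Avoids321 f) (p : ℕ) :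
    ((tableauOf f p).getD 0 []).Pairwise (· < ·) ∧
      (∀ z, z ∈ (tableauOf f p).getD 0 [] ↔ z ∈ (rows f p).1) ∧
      ∀ z, z ∈ (tableauOf f p).getD 1 [] ↔ z ∈ (rows f p).2 := by
  induction p with
  | zero => simp [tableauOf, rows_zero]
  | succ p ih =>
    obtain ⟨h1, h2, h3⟩ := ih
    rw [tableauOf_succ, tableauInsert_row_one]
    have hnot := (notMem_rows hf (Nat.lt_succ_self p)).1
    rcases rows_succ_cases f p with ⟨hle, h⟩ | ⟨y, hy, hxy, hmin, h⟩
    · have e := rowInsert_of_forall_le (x := f (p + 1)) (r := (tableauOf f p).getD 0 [])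
        fun y hy => hle y ((h2 y).1 hy)
      rw [tableauInsert_row_two_of_none (by rw [e]), e, h]
      refine ⟨?_, fun z => ?_, h3⟩
      · rw [List.pairwise_append]
        refine ⟨h1, List.pairwise_singleton _ _, fun a ha b hb => ?_⟩
        rw [List.mem_singleton] at hb
        subst hb
        have ha' := (h2 a).1 ha
        refine lt_of_le_of_ne (hle a ha') ?_
        rintro rfl
        exact hnot ha'
      · rw [Finset.mem_insert, ← h2]
        simp [or_comm]
    · obtain ⟨e1, e2, e3⟩ := rowInsert_of_min h1 (fun h => hnot ((h2 _).1 h)) ((h2 y).2 hy) hxy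
        fun z hz => hmin z ((h2 z).1 hz)
      rw [tableauInsert_row_two_of_some e1, rowInsert_of_forall_le (x := y), h]
      · refine ⟨e2, fun z => ?_, fun z => ?_⟩
        · rw [e3, h2, Finset.mem_insert, Finset.mem_erase]
        · rw [List.mem_append, List.mem_singleton, h3, Finset.mem_insert, or_comm]
      · intro z hz
        exact (lt_of_bump hf h321 hy hxy ((h3 z).1 hz)).le

/-- The letters, as integers, that are bumped from the first row. -/
def bumped (f : ℕ → ℕ) (n : ℕ) : Set ℤ := {z | ∃ a ∈ (rows f n).2, z = (a : ℤ)}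

theorem rowTwo_insertionTableau {n : ℕ} (w : Equiv.Perm (Fin n)) (h321 : Avoids321 (letter w)) :
    rowTwo (insertionTableau w) = bumped (letter w) n := by
  ext z
  simp only [rowTwo, bumped, Set.mem_ofPred_eq, insertionTableau_eq,
    (tableauOf_rows (letter_injective w) h321 n).2.2]

theorem mem_crowdedFC_iff {n : ℕ} (w : Equiv.Perm (Fin n)) :
    w ∈ crowdedFC n ↔ Avoids321 (letter w) ∧ IsCrowded (bumped (letter w) n) := by
  constructor
  · rintro ⟨h1, h2⟩
    have h := avoids321_of_isFullyCommutative w h1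
    exact ⟨h, rowTwo_insertionTableau w h ▸ h2⟩
  · rintro ⟨h1, h2⟩
    exact ⟨isFullyCommutative_of_avoids321 w h1, (rowTwo_insertionTableau w h1).symm ▸ h2⟩

end Rows

end FCPerm

namespace FCPerm

/-! ### Undoing a descent -/

section UndoDescent

variable {f : ℕ → ℕ}

/-- `f` with the letters in positions `p` and `p + 1` swapped. -/
def swapAt (f : ℕ → ℕ) (p : ℕ) (q : ℕ) : ℕ := f (Equiv.swap p (p + 1) q)

lemma swapAt_left (f : ℕ → ℕ) (p : ℕ) : swapAt f p p = f (p + 1) := by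
  rw [swapAt, Equiv.swap_apply_left]

lemma swapAt_right (f : ℕ → ℕ) (p : ℕ) : swapAt f p (p + 1) = f p := by
  rw [swapAt, Equiv.swap_apply_right]

lemma swapAt_of_ne (f : ℕ → ℕ) {p q : ℕ} (h1 : q ≠ p) (h2 : q ≠ p + 1) : swapAt f p q = f q := by
  rw [swapAt, Equiv.swap_apply_of_ne_of_ne h1 h2]

lemma rows_swapAt_of_le (f : ℕ → ℕ) (p : ℕ) : rows (swapAt f (p + 1)) p = rows f p :=
  rows_congr p fun q hq => swapAt_of_ne f (by omega) (by omega)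

lemma rows_swapAt_two (f : ℕ → ℕ) (p : ℕ) :
    rows (swapAt f (p + 1)) (p + 2) = popStep (popStep (rows f p) (f (p + 2))) (f (p + 1)) := by
  rw [rows_succ, rows_succ, rows_swapAt_of_le, swapAt_left, swapAt_right]

/-- A letter with a smaller letter to its right exceeds all letters before it. -/
lemma Avoids321.lt_of_inversion (hf : Function.Injective f) (h321 : Avoids321 f) {p q r : ℕ}
    (hpr : p < r) (h : f r < f p) (hqp : q < p) : f q < f p := by
  by_contra hlt
  have hne : f q ≠ f p := hf.ne hqp.ne
  exact h321 q p r hqp hpr (by omega) h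

lemma lt_of_mem_rows {p x y : ℕ} (hx : ∀ q, 1 ≤ q → q ≤ p → f q < x) (hy : y ∈ (rows f p).1) :
    y < x := by
  obtain ⟨q, hq1, hq2, rfl⟩ := (mem_rows f p y).1 (Or.inl hy)
  exact hx q hq1 hq2

/-- The Knuth relation in which the swapped letters follow the intermediate one. -/
lemma popStep_comm_of_bump {S : Finset ℕ × Finset ℕ} {a x y : ℕ} (hmax : ∀ y ∈ S.1, y < a)
    (hy : y ∈ S.1) (hxy : x < y) : popStep (popStep S x) a = popStep (popStep S a) x := by
  obtain ⟨z, hz, hxz, hmin⟩ := (forall_le_or_exists_min S.1 x).resolve_left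
    fun h => by have := h y hy; omega
  have hza := hmax z hz
  rw [popStep_of_min hz hxz hmin, popStep_of_forall_le (S := S) fun y hy => (hmax y hy).le,
    popStep_of_forall_le, popStep_of_min (y := z)]
  · refine Prod.ext ?_ rfl
    ext t
    simp only [Finset.mem_insert, Finset.mem_erase]
    by_cases htz : t = z
    · subst htz
      omega
    · tauto
  · simp [hz]
  · exact hxz
  · simp only [Finset.mem_insert]
    rintro t (rfl | ht) hxt
    · exact hza.le
    · exact hmin t ht hxt
  · simp only [Finset.mem_insert, Finset.mem_erase]
    rintro t (rfl | ⟨-, ht⟩)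
    · omega
    · exact (hmax t ht).le

lemma popStep_popStep_of_descent {S : Finset ℕ × Finset ℕ} {a x : ℕ} (hmax : ∀ y ∈ S.1, y < x)
    (hxa : x < a) : popStep (popStep S a) x = (insert x S.1, insert a S.2) := by
  have ha : a ∉ S.1 := fun h => by have := hmax _ h; omega
  rw [popStep_of_forall_le (S := S) fun y hy => ((hmax y hy).trans hxa).le,
    popStep_of_min (y := a) (by simp) hxa]
  · rw [Finset.erase_insert ha]
  · simp only [Finset.mem_insert]
    rintro t (rfl | ht) h
    · exact le_rfl
    · have := hmax t ht; omega

lemma popStep_popStep_of_ascent {S : Finset ℕ × Finset ℕ} {a x : ℕ} (hmax : ∀ y ∈ S.1, y < x)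
    (hxa : x < a) : popStep (popStep S x) a = (insert a (insert x S.1), S.2) := by
  rw [popStep_of_forall_le (S := S) fun y hy => (hmax y hy).le, popStep_of_forall_le]
  simp only [Finset.mem_insert]
  rintro t (rfl | ht)
  · exact hxa.le
  · exact ((hmax t ht).trans hxa).le

/-- The Knuth relation in which the swapped letters precede the intermediate one. -/
lemma popStep_comm_of_between {S : Finset ℕ × Finset ℕ} {a x c : ℕ} (hmax : ∀ y ∈ S.1, y < x)
    (hxc : x < c) (hca : c < a) :
    popStep (popStep (popStep S x) a) c = popStep (popStep (popStep S a) x) c := by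
  have ha : a ∉ S.1 := fun h => by have := hmax _ h; omega
  rw [popStep_popStep_of_ascent hmax (hxc.trans hca),
    popStep_popStep_of_descent hmax (hxc.trans hca), popStep_of_min (y := a) (by simp) hca,
    popStep_of_forall_le (S := (insert x S.1, _)), Finset.erase_insert]
  · simp only [Finset.mem_insert, not_or]
    exact ⟨by omega, ha⟩
  · simp only [Finset.mem_insert]
    rintro t (rfl | ht)
    · exact hxc.le
    · exact ((hmax t ht).trans hxc).le
  · simp only [Finset.mem_insert]
    rintro t (rfl | rfl | ht) h
    · exact le_rfl
    · omega
    · have := hmax t ht; omega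

lemma rows_swapAt_eq_of_bump {p y : ℕ} (hmax : ∀ y ∈ (rows f p).1, y < f (p + 1))
    (hy : y ∈ (rows f p).1) (hxy : f (p + 2) < y) :
    rows (swapAt f (p + 1)) (p + 2) = rows f (p + 2) := by
  rw [rows_swapAt_two]
  exact popStep_comm_of_bump hmax hy hxy

lemma rows_swapAt_eq_of_between {p : ℕ} (hmax : ∀ y ∈ (rows f p).1, y < f (p + 2))
    (h1 : f (p + 2) < f (p + 3)) (h2 : f (p + 3) < f (p + 1)) :
    rows (swapAt f (p + 1)) (p + 3) = rows f (p + 3) := by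
  rw [rows_succ, rows_swapAt_two, swapAt_of_ne f (by omega) (by omega)]
  exact popStep_comm_of_between hmax h1 h2

/-- Undoing a descent whose top is smaller than all later letters loses at most this top. -/
lemma rows_snd_subset_swapAt {p m : ℕ} (hmax : ∀ y ∈ (rows f p).1, y < f (p + 2))
    (hd : f (p + 2) < f (p + 1)) (hlater : ∀ q, p + 2 < q → f (p + 1) < f q) (hm : p + 2 ≤ m) :
    (rows f m).2 ⊆ insert (f (p + 1)) (rows (swapAt f (p + 1)) m).2 := by
  -- The induction needs the first rows too: they differ only by the top, which stays in the row of
  -- the swapped word because all later letters exceed it.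
  suffices h : (rows (swapAt f (p + 1)) m).1 = insert (f (p + 1)) (rows f m).1 ∧
      (rows f m).2 ⊆ insert (f (p + 1)) (rows (swapAt f (p + 1)) m).2 from h.2
  induction m, hm using Nat.le_induction with
  | base =>
    have h : rows f (p + 2) = (insert (f (p + 2)) (rows f p).1, insert (f (p + 1)) (rows f p).2) :=
      popStep_popStep_of_descent hmax hd
    rw [rows_swapAt_two, popStep_popStep_of_ascent hmax hd, h]
    simp
  | succ m hm ih =>
    obtain ⟨ih1, ih2⟩ := ih
    have hc := hlater (m + 1) (by omega)
    have hg : swapAt f (p + 1) (m + 1) = f (m + 1) := swapAt_of_ne f (by omega) (by omega)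
    rw [rows_succ, hg]
    rcases rows_succ_cases f m with ⟨hle, h⟩ | ⟨y, hy, hxy, hmin, h⟩
    · rw [h, popStep_of_forall_le]
      · exact ⟨by rw [ih1, Finset.insert_comm], ih2⟩
      · rw [ih1]
        simp only [Finset.mem_insert]
        rintro t (rfl | ht)
        · omega
        · exact hle t ht
    · rw [h, popStep_of_min (y := y)]
      · constructor
        · rw [ih1, Finset.erase_insert_of_ne (by omega), Finset.insert_comm]
        · rw [Finset.insert_comm]
          exact Finset.insert_subset_insert _ ih2
      · rw [ih1]
        exact Finset.mem_insert_of_mem hy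
      · exact hxy
      · rw [ih1]
        simp only [Finset.mem_insert]
        rintro t (rfl | ht) h
        · omega
        · exact hmin t ht h

/-- If every letter that is not a descent bottom is a left-to-right maximum, and every descent
bottom exceeds all letters of the row before the descent top, then the descent tops are bumped. -/
lemma mem_rows_snd_iff_descent (hf : Function.Injective f)
    (hmax : ∀ p, f p < f (p + 1) → ∀ q ≤ p, f q < f (p + 1))
    (hrow : ∀ p, f (p + 2) < f (p + 1) →
      (∀ z, z ∈ (rows f p).2 ↔ ∃ q, 1 ≤ q ∧ q + 1 ≤ p ∧ f (q + 1) < f q ∧ f q = z) →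
      ∀ y ∈ (rows f p).1, y < f (p + 2)) (p z : ℕ) :
    z ∈ (rows f p).2 ↔ ∃ q, 1 ≤ q ∧ q + 1 ≤ p ∧ f (q + 1) < f q ∧ f q = z := by
  induction p using Nat.strong_induction_on generalizing z with
  | _ p ih =>
  rcases p with _ | p
  · simp [rows_zero]
  have split : (∃ q, 1 ≤ q ∧ q + 1 ≤ p + 1 ∧ f (q + 1) < f q ∧ f q = z) ↔
      (1 ≤ p ∧ f (p + 1) < f p ∧ f p = z) ∨
        ∃ q, 1 ≤ q ∧ q + 1 ≤ p ∧ f (q + 1) < f q ∧ f q = z := by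
    constructor
    · rintro ⟨q, h1, h2, h3, h4⟩
      by_cases hq : q = p
      · subst hq
        exact Or.inl ⟨h1, h3, h4⟩
      · exact Or.inr ⟨q, h1, by omega, h3, h4⟩
    · rintro (⟨h1, h2, h3⟩ | ⟨q, h1, h2, h3⟩)
      · exact ⟨p, h1, le_rfl, h2, h3⟩
      · exact ⟨q, h1, by omega, h3⟩
  rw [split, ← ih p (by omega)]
  by_cases hp : 1 ≤ p ∧ f (p + 1) < f p
  · obtain ⟨p, rfl⟩ : ∃ p', p = p' + 1 := ⟨p - 1, by omega⟩
    -- The premise of `hrow` is the claim itself at an earlier position, available by induction;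
    -- `IsBlock.mem_rows_snd_iff` relies on it.
    have hlt := hrow p hp.2 (ih p (by omega))
    have htop : f (p + 1) ∈ (rows f (p + 1)).1 := by
      rcases rows_succ_cases f p with ⟨-, h⟩ | ⟨y, -, -, -, h⟩ <;> rw [h] <;> simp
    have hsub : ∀ y ∈ (rows f (p + 1)).1, y = f (p + 1) ∨ y ∈ (rows f p).1 := by
      intro y hy
      rcases rows_succ_cases f p with ⟨-, h⟩ | ⟨y, -, -, -, h⟩ <;> rw [h] at hy <;>
        simp only [Finset.mem_insert, Finset.mem_erase] at hy <;> tauto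
    rw [rows_succ f (p + 1), popStep_of_min htop hp.2]
    · simp only [Finset.mem_insert]
      have := hp.2
      constructor
      · rintro (h | h)
        · exact Or.inl ⟨by omega, this, h.symm⟩
        · exact Or.inr h
      · rintro (h | h)
        · exact Or.inl h.2.2.symm
        · exact Or.inr h
    · intro y hy hxy
      rcases hsub y hy with rfl | hy
      · exact le_rfl
      · have : y < f (p + 1 + 1) := hlt y hy
        omega
  · have hle : ∀ y ∈ (rows f p).1, y ≤ f (p + 1) := by
      intro y hy
      obtain ⟨q, hq1, hq2, rfl⟩ := (mem_rows f p y).1 (Or.inl hy)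
      have hne : f p ≠ f (p + 1) := hf.ne (by omega)
      exact (hmax p (by omega) q hq2).le
    rw [rows_succ, popStep_of_forall_le hle]
    constructor
    · exact Or.inr
    · rintro (⟨h1, h2, -⟩ | h)
      · exact absurd ⟨h1, h2⟩ hp
      · exact h

end UndoDescent

/-! ### Crowded sets -/

section Crowded

lemma IsUncrowded.mono {L M : Set ℤ} (hM : IsUncrowded M) (h : L ⊆ M) : IsUncrowded L := by
  intro x y hx
  refine le_trans ?_ (hM x y hx)
  exact_mod_cast Set.ncard_le_ncard (Set.inter_subset_inter_right _ h)
    ((Set.finite_Icc _ _).inter_of_left _)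

lemma IsCrowded.mono {L M : Set ℤ} (hL : IsCrowded L) (h : L ⊆ M) : IsCrowded M :=
  fun hM => hL (hM.mono h)

lemma isCrowded_iff {L : Set ℤ} :
    IsCrowded L ↔ ∃ x y : ℤ, 0 < x ∧ x + 2 ≤ ((Set.Icc y (y + 2 * x) ∩ L).ncard : ℤ) := by
  simp only [IsCrowded, IsUncrowded, not_forall, not_le]
  constructor
  · rintro ⟨x, y, hx, h⟩
    exact ⟨x, y, hx, by omega⟩
  · rintro ⟨x, y, hx, h⟩
    exact ⟨x, y, hx, by omega⟩

/-- A set is crowded if an interval of even length contains too many of its elements, where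
the interval is bounded by its number of elements only. -/
lemma isCrowded_of_card {L : Set ℤ} (y z : ℤ) (S : Finset ℤ) (hS : ∀ s ∈ S, s ∈ L ∧ y ≤ s ∧ s ≤ z)
    (hne : S.Nonempty) (hcard : z - y + 4 ≤ 2 * (S.card : ℤ)) : IsCrowded L := by
  obtain ⟨s, hs⟩ := hne
  have hyz : y ≤ z := (hS s hs).2.1.trans (hS s hs).2.2
  have hsub : (S : Set ℤ) ⊆ Set.Icc y (y + 2 * ((S.card : ℤ) - 2)) ∩ L := by
    intro t ht
    obtain ⟨h1, h2, h3⟩ := hS t ht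
    exact ⟨⟨h2, by omega⟩, h1⟩
  have hle := Set.ncard_le_ncard hsub ((Set.finite_Icc _ _).inter_of_left _)
  rw [Set.ncard_coe_finset] at hle
  -- From `|S| ≤ z - y + 1` and `hcard` follows `|S| ≥ 3`, so `x = |S| - 2` is positive.
  have hle2 : S ⊆ Finset.Icc y z := fun t ht => Finset.mem_Icc.2 (hS t ht).2
  have hle3 := Finset.card_le_card hle2
  rw [Int.card_Icc] at hle3
  refine isCrowded_iff.2 ⟨(S.card : ℤ) - 2, y, ?_, ?_⟩
  · by_contra h
    omega
  · omega

/-- A sequence that increases by two at each step, up to one, has uncrowded range. -/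
lemma isUncrowded_of_gaps {a : ℕ → ℤ} {k : ℕ}
    (h : ∀ i j, i < j → j < k → 2 * ((j : ℤ) - i) - 1 ≤ a j - a i) :
    IsUncrowded {z | ∃ i < k, z = a i} := by
  intro x y hx
  classical
  set S := (Finset.range k).filter fun i => y ≤ a i ∧ a i ≤ y + 2 * x with hS
  have himage : Set.Icc y (y + 2 * x) ∩ {z | ∃ i < k, z = a i} = ((S.image a : Finset ℤ) : Set ℤ) := by
    ext z
    simp only [hS, Set.mem_inter_iff, Set.mem_Icc, Set.mem_ofPred_eq, Finset.coe_image,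
      Finset.coe_filter, Finset.mem_range, Set.mem_image]
    constructor
    · rintro ⟨h1, i, hi, rfl⟩
      exact ⟨i, ⟨hi, h1⟩, rfl⟩
    · rintro ⟨i, ⟨hi, h1⟩, rfl⟩
      exact ⟨h1, i, hi, rfl⟩
  rw [himage, Set.ncard_coe_finset]
  refine le_trans (Int.ofNat_le.2 Finset.card_image_le) ?_
  rcases S.eq_empty_or_nonempty with hE | hne
  · rw [hE]
    simp
    omega
  · have hi := S.min'_mem hne
    have hj := S.max'_mem hne
    have hsub : S ⊆ Finset.Icc (S.min' hne) (S.max' hne) := fun t ht =>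
      Finset.mem_Icc.2 ⟨S.min'_le t ht, S.le_max' t ht⟩
    have hcard := Finset.card_le_card hsub
    rw [Nat.card_Icc] at hcard
    have hle : S.min' hne ≤ S.max' hne := S.min'_le _ hj
    generalize S.min' hne = i at *
    generalize S.max' hne = j at *
    simp only [hS, Finset.mem_filter, Finset.mem_range] at hi hj
    rcases hle.eq_or_lt with rfl | hlt
    · omega
    -- Here `2(j - i) - 1 ≤ 2x`, so `j - i ≤ x` by parity.
    · have := h i j hlt hj.1
      omega

end Crowded

end FCPerm

namespace FCPerm

/-! ### Permutations whose inversions form one block -/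

section Block

/-- A letter that is not a descent bottom is a left-to-right maximum, as soon as the letter
after each descent exceeds the descent top. -/
lemma lt_of_ascent {f : ℕ → ℕ} (hf : Function.Injective f)
    (h : ∀ p, f (p + 1) < f p → f p < f (p + 2)) (p : ℕ) (hp : f p < f (p + 1)) (q : ℕ)
    (hq : q ≤ p) : f q < f (p + 1) := by
  induction p using Nat.strong_induction_on generalizing q with
  | _ p ih =>
  rcases hq.eq_or_lt with rfl | hq
  · exact hp
  obtain ⟨p, rfl⟩ : ∃ p', p = p' + 1 := ⟨p - 1, by omega⟩
  rcases lt_or_ge (f p) (f (p + 1)) with h1 | h1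
  · exact (ih p (by omega) h1 q (by omega)).trans hp
  have hne : f p ≠ f (p + 1) := hf.ne (by omega)
  -- Now `p` is a descent top. The position before it cannot be a descent, so its letter is a
  -- left-to-right maximum by induction.
  have h2 := h p (by omega)
  rcases Nat.lt_or_ge q p with hqp | hqp
  · obtain ⟨p, rfl⟩ : ∃ p', p = p' + 1 := ⟨p - 1, by omega⟩
    have h3 : f p < f (p + 1) := by
      by_contra h3
      have hne' : f p ≠ f (p + 1) := hf.ne (by omega)
      have : f p < f (p + 1 + 1) := h p (by omega)
      omega
    exact (ih p (by omega) h3 q (by omega)).trans h2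
  · obtain rfl : q = p := by omega
    exact h2

/-- The descents of the one-line notation `f` are `d, d + 2, …, d + 2k`, their bottoms increase,
each top exceeds the next bottom, and there are no inversions other than those between a descent
top and a later descent bottom. -/
structure IsBlock (f : ℕ → ℕ) (d k : ℕ) : Prop where
  descent_iff : ∀ p, f (p + 1) < f p ↔ ∃ i ≤ k, p = d + 2 * i
  max : ∀ p, f p < f (p + 1) → ∀ q ≤ p, f q < f (p + 1)
  bottom_lt : ∀ i j, i < j → j ≤ k → f (d + 2 * i + 1) < f (d + 2 * j + 1)
  cross : ∀ i, i < k → f (d + 2 * i + 3) < f (d + 2 * i)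
  descent_of_lt : ∀ p q, f (p + 1) < f p → q < p → f (p + 1) < f q → f (q + 1) < f q

variable {n : ℕ} {w : Equiv.Perm (Fin n)} {d k : ℕ}

lemma lt_succ_of_not_descent (w : Equiv.Perm (Fin n)) {p : ℕ}
    (h : ¬ letter w (p + 1) < letter w p) : letter w p < letter w (p + 1) := by
  have : letter w p ≠ letter w (p + 1) := (letter_injective w).ne (by omega)
  omega

namespace IsBlock

lemma descent (h : IsBlock (letter w) d k) {i : ℕ} (hi : i ≤ k) :
    letter w (d + 2 * i + 1) < letter w (d + 2 * i) :=
  (h.descent_iff _).2 ⟨i, hi, rfl⟩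

lemma max_of_not_bottom (h : IsBlock (letter w) d k) {p q : ℕ}
    (hp : ∀ i ≤ k, p ≠ d + 2 * i + 1) (hq : q < p) : letter w q < letter w p := by
  obtain ⟨p, rfl⟩ : ∃ p', p = p' + 1 := ⟨p - 1, by omega⟩
  refine h.max p (lt_succ_of_not_descent w fun h' => ?_) q (by omega)
  obtain ⟨i, hi, rfl⟩ := (h.descent_iff p).1 h'
  exact hp i hi rfl

lemma top_lt (h : IsBlock (letter w) d k) {i j : ℕ} (hij : i < j) :
    letter w (d + 2 * i) < letter w (d + 2 * j) :=
  h.max_of_not_bottom (fun _ _ => by omega) (by omega)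

/-- The smaller letter is not a left-to-right maximum, hence a bottom; the larger one is then a top
by `descent_of_lt`. -/
lemma exists_of_inversion (h : IsBlock (letter w) d k) {p q : ℕ} (hpq : p < q)
    (hlt : letter w q < letter w p) :
    ∃ i j, i ≤ j ∧ j ≤ k ∧ p = d + 2 * i ∧ q = d + 2 * j + 1 := by
  have hq : ∃ j ≤ k, q = d + 2 * j + 1 := by
    by_contra! hq
    have := h.max_of_not_bottom hq hpq
    omega
  obtain ⟨j, hj, rfl⟩ := hq
  have hp : letter w (p + 1) < letter w p := by
    rcases Nat.lt_or_ge p (d + 2 * j) with hp | hp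
    · exact h.descent_of_lt _ _ (h.descent hj) hp hlt
    · obtain rfl : p = d + 2 * j := by omega
      exact hlt
  obtain ⟨i, hi, rfl⟩ := (h.descent_iff p).1 hp
  exact ⟨i, j, by omega, hj, rfl, rfl⟩

lemma avoids321 (h : IsBlock (letter w) d k) : Avoids321 (letter w) := by
  intro p q r hpq hqr h1 h2
  obtain ⟨i, j, -, -, rfl, rfl⟩ := h.exists_of_inversion hpq h1
  obtain ⟨i', j', -, -, h3, -⟩ := h.exists_of_inversion hqr h2
  omega

lemma exists_of_inv (h : IsBlock (letter w) d k) {a b : ℕ} (hab : Inv w a b) :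
    ∃ i j, i ≤ j ∧ j ≤ k ∧ a = letter w (d + 2 * i) ∧ b = letter w (d + 2 * j + 1) := by
  obtain ⟨p, rfl⟩ := letter_surjective w a
  obtain ⟨q, rfl⟩ := letter_surjective w b
  rw [inv_letter_iff] at hab
  obtain ⟨i, j, hij, hj, rfl, rfl⟩ := h.exists_of_inversion hab.2 hab.1
  exact ⟨i, j, hij, hj, rfl, rfl⟩

/-- As `letter w` is a bijection of `ℕ`, with 0 included, `letter w p` is the number of positions
carrying smaller letters. -/
lemma card_le_letter (w : Equiv.Perm (Fin n)) {p : ℕ} (S : Finset ℕ)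
    (hS : ∀ q ∈ S, letter w q < letter w p) : S.card ≤ letter w p := by
  have : S.image (letter w) ⊆ Finset.range (letter w p) := by
    intro z hz
    obtain ⟨q, hq, rfl⟩ := Finset.mem_image.1 hz
    exact Finset.mem_range.2 (hS q hq)
  have := Finset.card_le_card this
  rwa [Finset.card_image_of_injective _ (letter_injective w), Finset.card_range] at this

lemma letter_le_card (w : Equiv.Perm (Fin n)) {p : ℕ} (S : Finset ℕ)
    (hS : ∀ q, letter w q < letter w p → q ∈ S) : letter w p ≤ S.card := by
  have : Finset.range (letter w p) ⊆ S.image (letter w) := by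
    intro z hz
    obtain ⟨q, rfl⟩ := letter_surjective w z
    exact Finset.mem_image_of_mem _ (hS q (Finset.mem_range.1 hz))
  have := (Finset.card_le_card this).trans Finset.card_image_le
  rwa [Finset.card_range] at this

/-- Smaller letters sit at the `d + 2i` positions before the top, counting position 0, and at the `m
+ 1` bottoms `i, …, i + m`. -/
lemma le_top (h : IsBlock (letter w) d k) {i m : ℕ} (hm : i + m ≤ k)
    (hlt : letter w (d + 2 * (i + m) + 1) < letter w (d + 2 * i)) :
    d + 2 * i + m + 1 ≤ letter w (d + 2 * i) := by
  have hdisj : Disjoint (Finset.range (d + 2 * i))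
      ((Finset.range (m + 1)).image fun j => d + 2 * (i + j) + 1) := by
    rw [Finset.disjoint_left]
    intro q hq hq'
    rw [Finset.mem_range] at hq
    obtain ⟨j, -, rfl⟩ := Finset.mem_image.1 hq'
    omega
  have := card_le_letter w (p := d + 2 * i) (Finset.range (d + 2 * i) ∪
    (Finset.range (m + 1)).image fun j => d + 2 * (i + j) + 1) ?_
  · rw [Finset.card_union_of_disjoint hdisj, Finset.card_range,
      Finset.card_image_of_injective _ (fun a b hab => by simp at hab; omega),
      Finset.card_range] at this
    omega
  · intro q hq
    rw [Finset.mem_union, Finset.mem_range, Finset.mem_image] at hq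
    rcases hq with hq | ⟨j, hj, rfl⟩
    · exact h.max_of_not_bottom (fun _ _ => by omega) hq
    · rw [Finset.mem_range] at hj
      rcases Nat.lt_or_ge j m with hjm | hjm
      · exact (h.bottom_lt (i + j) (i + m) (by omega) hm).trans hlt
      · obtain rfl : j = m := by omega
        exact hlt

/-- The converse count. The hypothesis is an implication, so that the bound also covers `i + m > k`,
where no further bottom exists. -/
lemma top_le (h : IsBlock (letter w) d k) {i m : ℕ}
    (hlt : i + m ≤ k → letter w (d + 2 * i) < letter w (d + 2 * (i + m) + 1)) :
    letter w (d + 2 * i) ≤ d + 2 * i + m := by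
  refine (letter_le_card w (Finset.range (d + 2 * i) ∪
    (Finset.range m).image fun j => d + 2 * (i + j) + 1) fun q hq => ?_).trans ?_
  · rw [Finset.mem_union, Finset.mem_range, Finset.mem_image]
    rcases Nat.lt_or_ge q (d + 2 * i) with hqi | hqi
    · exact Or.inl hqi
    · have hne : q ≠ d + 2 * i := by
        rintro rfl
        omega
      obtain ⟨i', j, hij, hj, h1, rfl⟩ := h.exists_of_inversion
        (p := d + 2 * i) (q := q) (by omega) hq
      refine Or.inr ⟨j - i, ?_, by omega⟩
      rw [Finset.mem_range]
      by_contra hm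
      have h2 := hlt (by omega)
      rcases Nat.lt_or_ge (i + m) j with h3 | h3
      · have := h.bottom_lt _ _ h3 hj
        omega
      · obtain rfl : j = i + m := by omega
        omega
  · refine (Finset.card_union_le _ _).trans ?_
    have := Finset.card_image_le (s := Finset.range m) (f := fun j => d + 2 * (i + j) + 1)
    rw [Finset.card_range] at *
    omega

/-- The descent tops, as integers. -/
lemma bumped_eq (h : IsBlock (letter w) d k)
    (hrows : ∀ z, z ∈ (rows (letter w) n).2 ↔
      ∃ q, 1 ≤ q ∧ q + 1 ≤ n ∧ letter w (q + 1) < letter w q ∧ letter w q = z) :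
    bumped (letter w) n = {z : ℤ | ∃ i < k + 1, z = (letter w (d + 2 * i) : ℤ)} := by
  ext z
  simp only [bumped, Set.mem_ofPred_eq, hrows]
  constructor
  · rintro ⟨a, ⟨q, -, -, hq, rfl⟩, rfl⟩
    obtain ⟨i, hi, rfl⟩ := (h.descent_iff q).1 hq
    exact ⟨i, by omega, rfl⟩
  · rintro ⟨i, hi, rfl⟩
    have hd := h.descent (i := i) (by omega)
    have := mem_of_descent w hd
    exact ⟨_, ⟨d + 2 * i, this.1, by omega, hd, rfl⟩, rfl⟩

end IsBlock

/-! ### The two six-letter patterns as chains of inequalities -/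

lemma sameRelativeOrder_415263_iff (v : Fin 6 → ℕ) :
    SameRelativeOrder v ![4, 1, 5, 2, 6, 3] ↔
      v 1 < v 3 ∧ v 3 < v 5 ∧ v 5 < v 0 ∧ v 0 < v 2 ∧ v 2 < v 4 := by
  constructor
  · intro h
    exact ⟨(h 1 3).2 (by decide), (h 3 5).2 (by decide), (h 5 0).2 (by decide),
      (h 0 2).2 (by decide), (h 2 4).2 (by decide)⟩
  · rintro ⟨h1, h2, h3, h4, h5⟩ i j
    fin_cases i <;> fin_cases j <;> simp <;> omega

lemma sameRelativeOrder_315264_iff (v : Fin 6 → ℕ) :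
    SameRelativeOrder v ![3, 1, 5, 2, 6, 4] ↔
      v 1 < v 3 ∧ v 3 < v 0 ∧ v 0 < v 5 ∧ v 5 < v 2 ∧ v 2 < v 4 := by
  constructor
  · intro h
    exact ⟨(h 1 3).2 (by decide), (h 3 0).2 (by decide), (h 0 5).2 (by decide),
      (h 5 2).2 (by decide), (h 2 4).2 (by decide)⟩
  · rintro ⟨h1, h2, h3, h4, h5⟩ i j
    fin_cases i <;> fin_cases j <;> simp <;> omega

end Block

/-! ### Minimal crowded permutations -/

section Minimal

variable {n : ℕ} {w : Equiv.Perm (Fin n)}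

lemma letter_mul_simpleReflection_eq_swapAt (w : Equiv.Perm (Fin n)) (i : Fin (n - 1)) :
    letter (w * simpleReflection i) = swapAt (letter w) (i + 1) := by
  ext p
  rw [letter_mul_simpleReflection, swapAt]

namespace IsMinimalCrowded

lemma avoids321 (hw : IsMinimalCrowded w) : Avoids321 (letter w) :=
  ((mem_crowdedFC_iff w).1 hw.1).1

lemma isCrowded (hw : IsMinimalCrowded w) : IsCrowded (bumped (letter w) n) :=
  ((mem_crowdedFC_iff w).1 hw.1).2

lemma isUncrowded_swapAt (hw : IsMinimalCrowded w) {p : ℕ}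
    (hp : letter w (p + 2) < letter w (p + 1)) :
    IsUncrowded (bumped (swapAt (letter w) (p + 1)) n) := by
  by_contra hc
  obtain ⟨i, hi⟩ := exists_fin_of_descent w hp
  obtain rfl : (i : ℕ) = p := by omega
  have hle := rightWeakLE_of_descent w i hp
  have hv := hw.2 _ ((mem_crowdedFC_iff _).2 ⟨hw.avoids321.of_rightWeakLE hle,
    letter_mul_simpleReflection_eq_swapAt w i ▸ hc⟩) hle
  have := letter_mul_simpleReflection_left w i
  rw [hv] at this
  omega

/-- Otherwise swapping the descent is a Knuth relation that leaves the rows unchanged, and the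
smaller permutation would be crowded too. -/
lemma row_lt (hw : IsMinimalCrowded w) {p : ℕ} (hp : letter w (p + 2) < letter w (p + 1))
    {y : ℕ} (hy : y ∈ (rows (letter w) p).1) : y < letter w (p + 2) := by
  by_contra hlt
  have hne : y ≠ letter w (p + 2) := by
    rintro rfl
    exact (notMem_rows (letter_injective w) (by omega)).1 hy
  have hn := mem_of_descent w hp
  have h1 := rows_swapAt_eq_of_bump (f := letter w) (p := p) (fun y hy =>
    lt_of_mem_rows (fun q _ hq => hw.avoids321.lt_of_inversion (letter_injective w)
      (show p + 1 < p + 2 by omega) hp (by omega)) hy) hy (by omega)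
  have h2 := rows_congr_after h1 (show p + 2 ≤ n by omega)
    fun q hq => swapAt_of_ne _ (by omega) (by omega)
  have h3 := hw.isUncrowded_swapAt hp
  rw [bumped, h2] at h3
  exact hw.isCrowded h3

/-- A third letter below the bottom gives a 321; one between bottom and top makes the swap a Knuth
relation. Past the end of the word, the extension by the identity makes the third letter exceed `n`.
-/
lemma lt_third (hw : IsMinimalCrowded w) {p : ℕ} (hp : letter w (p + 1) < letter w p) :
    letter w p < letter w (p + 2) := by
  have hn := mem_of_descent w hp
  obtain ⟨p, rfl⟩ : ∃ p', p = p' + 1 := ⟨p - 1, by omega⟩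
  rcases Nat.lt_or_ge n (p + 3) with hn3 | hn3
  · have := letter_mem w (i := p + 1) (by omega)
    rw [letter_of_not_mem w (i := p + 1 + 2) (by omega)]
    omega
  by_contra hlt
  have hne : letter w (p + 1) ≠ letter w (p + 3) := (letter_injective w).ne (by omega)
  have hne' : letter w (p + 2) ≠ letter w (p + 3) := (letter_injective w).ne (by omega)
  have hgt : letter w (p + 2) < letter w (p + 3) := by
    by_contra h
    exact hw.avoids321 (p + 1) (p + 2) (p + 3) (by omega) (by omega) hp (by omega)
  have h1 := rows_swapAt_eq_of_between (f := letter w) (p := p) (fun y hy => hw.row_lt hp hy)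
    hgt (by change ¬ letter w (p + 1) < letter w (p + 3) at hlt; omega)
  have h2 := rows_congr_after h1 hn3 fun q hq => swapAt_of_ne _ (by omega) (by omega)
  have h3 := hw.isUncrowded_swapAt hp
  rw [bumped, h2] at h3
  exact hw.isCrowded h3

lemma max (hw : IsMinimalCrowded w) (p : ℕ) (hp : letter w p < letter w (p + 1)) (q : ℕ)
    (hq : q ≤ p) : letter w q < letter w (p + 1) :=
  lt_of_ascent (letter_injective w) (fun _ h => hw.lt_third h) p hp q hq

lemma mem_rows_snd_iff (hw : IsMinimalCrowded w) (p z : ℕ) :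
    z ∈ (rows (letter w) p).2 ↔
      ∃ q, 1 ≤ q ∧ q + 1 ≤ p ∧ letter w (q + 1) < letter w q ∧ letter w q = z :=
  mem_rows_snd_iff_descent (letter_injective w) hw.max (fun _ hp _ _ hy => hw.row_lt hp hy) p z

/-- By `row_lt` the larger letter has left the first row by then, so it was bumped and is a descent
top. -/
lemma descent_of_lt (hw : IsMinimalCrowded w) (p q : ℕ) (hp : letter w (p + 1) < letter w p)
    (hqp : q < p) (hlt : letter w (p + 1) < letter w q) : letter w (q + 1) < letter w q := by
  obtain ⟨p, rfl⟩ : ∃ p', p = p' + 1 := ⟨p - 1, by omega⟩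
  rcases Nat.eq_zero_or_pos q with rfl | hq
  · rw [letter_of_not_mem w (i := 0) (by omega)] at hlt
    omega
  rcases (mem_rows (letter w) p _).2 ⟨q, hq, by omega, rfl⟩ with h | h
  · have : letter w q < letter w (p + 1 + 1) := hw.row_lt hp h
    omega
  · obtain ⟨r, -, -, hr, he⟩ := (hw.mem_rows_snd_iff p _).1 h
    rwa [letter_injective w he] at hr

lemma isUncrowded_diff (hw : IsMinimalCrowded w) {p : ℕ} (hp : letter w (p + 1) < letter w p)
    (hlater : ∀ q, p + 1 < q → letter w p < letter w q) :
    IsUncrowded (bumped (letter w) n \ {(letter w p : ℤ)}) := by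
  have hn := mem_of_descent w hp
  obtain ⟨p, rfl⟩ : ∃ p', p = p' + 1 := ⟨p - 1, by omega⟩
  refine (hw.isUncrowded_swapAt hp).mono ?_
  rintro _ ⟨⟨a, ha, rfl⟩, hne⟩
  have := rows_snd_subset_swapAt (fun y hy => hw.row_lt hp hy) hp hlater
    (show p + 2 ≤ n by omega) ha
  rw [Finset.mem_insert] at this
  refine ⟨a, this.resolve_left ?_, rfl⟩
  rintro rfl
  exact hne rfl

lemma bumped_eq_tops (hw : IsMinimalCrowded w) :
    bumped (letter w) n =
      {z : ℤ | ∃ p, letter w (p + 1) < letter w p ∧ z = (letter w p : ℤ)} := by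
  ext z
  simp only [bumped, Set.mem_ofPred_eq, hw.mem_rows_snd_iff]
  constructor
  · rintro ⟨_, ⟨q, -, -, hq, rfl⟩, rfl⟩
    exact ⟨q, hq, rfl⟩
  · rintro ⟨q, hq, rfl⟩
    have := mem_of_descent w hq
    exact ⟨_, ⟨q, this.1, by omega, hq, rfl⟩, rfl⟩

lemma exists_last (hw : IsMinimalCrowded w) :
    ∃ e, letter w (e + 1) < letter w e ∧ ∀ p, letter w (p + 1) < letter w p → p ≤ e := by
  have hne : ∃ p, letter w (p + 1) < letter w p := by
    by_contra hno
    refine hw.isCrowded ?_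
    have : bumped (letter w) n = ∅ := by
      rw [hw.bumped_eq_tops]
      ext z
      simp only [Set.mem_ofPred_eq, Set.mem_empty_iff_false, iff_false]
      rintro ⟨p, hp, -⟩
      exact hno ⟨p, hp⟩
    rw [this]
    intro x y hx
    simp
    omega
  obtain ⟨p, hp⟩ := hne
  have hbdd : ∀ q, letter w (q + 1) < letter w q → q ≤ n := fun q hq => (mem_of_descent w hq).2.le
  classical
  have := Nat.findGreatest_spec (P := fun q => letter w (q + 1) < letter w q) (hbdd p hp) hp
  exact ⟨_, this, fun q hq => Nat.le_findGreatest (hbdd q hq) hq⟩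

lemma lt_of_last (hw : IsMinimalCrowded w) {e : ℕ}
    (he : ∀ p, letter w (p + 1) < letter w p → p ≤ e) (q : ℕ) (hq : e + 1 < q) (p : ℕ)
    (hp : p < q) : letter w p < letter w q := by
  obtain ⟨q, rfl⟩ : ∃ q', q = q' + 1 := ⟨q - 1, by omega⟩
  refine hw.max q (lt_succ_of_not_descent w fun h => ?_) p (by omega)
  have := he q h
  omega

/-- The block does not split at a descent other than the last one. -/
lemma exists_lt_top (hw : IsMinimalCrowded w) {e j : ℕ} (hde : letter w (e + 1) < letter w e)
    (he : ∀ p, letter w (p + 1) < letter w p → p ≤ e) (hj : letter w (j + 1) < letter w j)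
    (hje : j < e) : ∃ q, j + 1 < q ∧ letter w q < letter w j := by
  by_contra! hno
  have hlater : ∀ q, j + 1 < q → letter w j < letter w q := fun q hq =>
    lt_of_le_of_ne (hno q hq) ((letter_injective w).ne (by omega))
  have hUj := hw.isUncrowded_diff hj hlater
  have hUe := hw.isUncrowded_diff hde fun q hq => hw.lt_of_last he q hq e (by omega)
  have hC := hw.isCrowded
  rw [hw.bumped_eq_tops] at hUj hUe hC
  set T : Set ℤ := {z : ℤ | ∃ p, letter w (p + 1) < letter w p ∧ z = (letter w p : ℤ)} with hT
  obtain ⟨x, y, hx, hxy⟩ := isCrowded_iff.1 hC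
  classical
  set U := (Finset.range (e + 1)).filter fun p => letter w (p + 1) < letter w p ∧
    y ≤ (letter w p : ℤ) ∧ (letter w p : ℤ) ≤ y + 2 * x with hU
  have himage : Set.Icc y (y + 2 * x) ∩ T =
      ((U.image fun p => (letter w p : ℤ) : Finset ℤ) : Set ℤ) := by
    ext z
    simp only [hU, hT, Set.mem_inter_iff, Set.mem_Icc, Set.mem_ofPred_eq, Finset.coe_image,
      Finset.coe_filter, Finset.mem_range, Set.mem_image]
    constructor
    · rintro ⟨h1, p, hp, rfl⟩
      have := he p hp
      exact ⟨p, ⟨by omega, hp, h1⟩, rfl⟩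
    · rintro ⟨p, ⟨-, hp, h1⟩, rfl⟩
      exact ⟨h1, p, hp, rfl⟩
  have hcardU : x + 2 ≤ (U.card : ℤ) := by
    rw [himage, Set.ncard_coe_finset] at hxy
    exact hxy.trans (Int.ofNat_le.2 Finset.card_image_le)
  -- Removing a top outside the crowded window would keep the set crowded; so the window contains
  -- the tops of both `j` and `e`.
  have hmemU : ∀ p, IsUncrowded (T \ {(letter w p : ℤ)}) → letter w (p + 1) < letter w p →
      p ∈ U := by
    intro p hun hp
    by_contra hpU
    have hlt : (x + 1 : ℤ) < _ := lt_of_lt_of_le (by omega) hxy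
    have := hun x y hx
    refine absurd this (not_le.2 (lt_of_lt_of_le hlt ?_))
    refine Int.ofNat_le.2 (Set.ncard_le_ncard ?_ ((Set.finite_Icc _ _).inter_of_left _))
    rintro z ⟨hz, hzT⟩
    refine ⟨hz, hzT, ?_⟩
    rintro rfl
    have := he p hp
    exact hpU (Finset.mem_filter.2 ⟨Finset.mem_range.2 (by omega), hp, hz⟩)
  have hjU := hmemU j hUj hj
  have heU := hmemU e hUe hde
  have hmono : ∀ p q, letter w (q + 1) < letter w q → p < q → letter w p < letter w q :=
    fun p q hq hpq => hw.avoids321.lt_of_inversion (letter_injective w) (Nat.lt_succ_self q) hq hpq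
  -- tops and bottoms after `j` are distinct letters between the tops of `j` and `e`
  have hcard2 : 2 * (U.filter fun p => ¬ p ≤ j).card ≤ letter w e - letter w j := by
    have hdisj : Disjoint ((U.filter fun p => ¬ p ≤ j).image (letter w))
        ((U.filter fun p => ¬ p ≤ j).image fun p => letter w (p + 1)) := by
      rw [Finset.disjoint_left]
      intro z hz hz'
      obtain ⟨p, hp, rfl⟩ := Finset.mem_image.1 hz
      obtain ⟨q, hq, h⟩ := Finset.mem_image.1 hz'
      have hqp : q + 1 = p := letter_injective w h
      subst hqp
      simp only [hU, Finset.mem_filter] at hp hq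
      exact hw.avoids321 q (q + 1) (q + 2) (by omega) (by omega) hq.1.2.1 hp.1.2.1
    have hsub : (U.filter fun p => ¬ p ≤ j).image (letter w) ∪
        (U.filter fun p => ¬ p ≤ j).image (fun p => letter w (p + 1)) ⊆
        Finset.Ioc (letter w j) (letter w e) := by
      intro z hz
      rw [Finset.mem_Ioc]
      simp only [hU, Finset.mem_union, Finset.mem_image, Finset.mem_filter,
        Finset.mem_range] at hz
      have hle : ∀ p, letter w (p + 1) < letter w p → letter w p ≤ letter w e := by
        intro p hp
        rcases (he p hp).eq_or_lt with rfl | h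
        · exact le_rfl
        · exact (hmono p e hde h).le
      rcases hz with ⟨p, ⟨⟨-, hp, -⟩, hpj⟩, rfl⟩ | ⟨p, ⟨⟨-, hp, -⟩, hpj⟩, rfl⟩
      · exact ⟨hmono j p hp (by omega), hle p hp⟩
      · have := hle p hp
        exact ⟨hlater (p + 1) (by omega), by omega⟩
    have := Finset.card_le_card hsub
    rw [Finset.card_union_of_disjoint hdisj,
      Finset.card_image_of_injective _ (letter_injective w),
      Finset.card_image_of_injective _
        (fun a b hab => by have := letter_injective w hab; omega), Nat.card_Ioc] at this
    omega
  have hsplit := Finset.card_filter_add_card_filter_not (s := U) (fun p => p ≤ j)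
  have hje' := hmono j e hde hje
  have hinj : Function.Injective fun p => (letter w p : ℤ) := fun a b hab =>
    letter_injective w (Int.ofNat_inj.1 hab)
  -- Cut the window at the top of `j`. The tops lost number at most half of `w(e) - w(j)`, so the
  -- rest is still crowded, yet it omits the top of `e`.
  refine isCrowded_of_card (L := T \ {(letter w e : ℤ)}) y (letter w j)
    ((U.filter fun p => p ≤ j).image fun p => (letter w p : ℤ)) ?_ ?_ ?_ hUe
  · intro s hs
    obtain ⟨p, hp, rfl⟩ := Finset.mem_image.1 hs
    simp only [hU, Finset.mem_filter] at hp
    obtain ⟨⟨-, hp, hy1, -⟩, hpj⟩ := hp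
    refine ⟨⟨⟨p, hp, rfl⟩, fun h => ?_⟩, hy1, ?_⟩
    · have : p = e := hinj h
      omega
    · rcases hpj.eq_or_lt with rfl | h
      · exact le_rfl
      · exact_mod_cast (hmono p j hj h).le
  · exact ⟨_, Finset.mem_image_of_mem _ (Finset.mem_filter.2 ⟨hjU, le_rfl⟩)⟩
  · rw [Finset.card_image_of_injective _ hinj]
    simp only [hU, Finset.mem_filter] at heU
    have := heU.2.2.2
    omega

/-- A later letter below the top of `j` is a bottom of some descent `r ≥ j + 2`. If `r > j + 2`, the
letter at `j + 2` exceeds that bottom, hence is a top, and avoiding 321 pushes its own bottom below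
the top of `j`. -/
lemma descent_add_two (hw : IsMinimalCrowded w) {e j : ℕ} (hde : letter w (e + 1) < letter w e)
    (he : ∀ p, letter w (p + 1) < letter w p → p ≤ e) (hj : letter w (j + 1) < letter w j)
    (hje : j < e) :
    letter w (j + 2 + 1) < letter w (j + 2) ∧ letter w (j + 3) < letter w j := by
  obtain ⟨q, hq, hlt⟩ := hw.exists_lt_top hde he hj hje
  obtain ⟨r, rfl⟩ : ∃ r, q = r + 1 := ⟨q - 1, by omega⟩
  have hr : letter w (r + 1) < letter w r := by
    by_contra h
    have := hw.max r (lt_succ_of_not_descent w h) j (by omega)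
    omega
  have h1 := hw.lt_third hj
  have hrj : r ≠ j + 1 := by
    rintro rfl
    have : letter w (j + 2) < letter w (j + 1) := hr
    omega
  rcases Nat.lt_or_ge (j + 2) r with h | h
  · have hd := hw.descent_of_lt r (j + 2) hr h (by omega)
    refine ⟨hd, ?_⟩
    by_contra h3
    exact hw.avoids321 (j + 2) (j + 3) (r + 1) (by omega) (by omega) hd (by omega)
  · obtain rfl : r = j + 2 := by omega
    exact ⟨hr, hlt⟩

theorem exists_isBlock (hw : IsMinimalCrowded w) : ∃ d k, IsBlock (letter w) d k := by
  obtain ⟨e, hde, he⟩ := hw.exists_last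
  classical
  have hex : ∃ p, letter w (p + 1) < letter w p := ⟨e, hde⟩
  have hd := Nat.find_spec hex
  have hmin : ∀ p, letter w (p + 1) < letter w p → Nat.find hex ≤ p :=
    fun p hp => Nat.find_min' hex hp
  generalize Nat.find hex = d at hd hmin
  have hstep : ∀ i, d + 2 * i ≤ e → letter w (d + 2 * i + 1) < letter w (d + 2 * i) := by
    intro i
    induction i with
    | zero => exact fun _ => hd
    | succ i ih =>
      intro hi
      exact (hw.descent_add_two hde he (ih (by omega)) (by omega)).1
  have hform : ∀ p, letter w (p + 1) < letter w p → ∃ i, p = d + 2 * i := by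
    intro p hp
    have h1 := hmin p hp
    have h2 := he p hp
    have h3 := hstep ((p - d) / 2) (by omega)
    by_cases h : p = d + 2 * ((p - d) / 2)
    · exact ⟨_, h⟩
    · have h4 : p = d + 2 * ((p - d) / 2) + 1 := by omega
      generalize (p - d) / 2 = i at *
      subst h4
      have h5 := hw.lt_third h3
      have : letter w (d + 2 * i + 2) < letter w (d + 2 * i + 1) := hp
      omega
  obtain ⟨k, rfl⟩ := hform e hde
  refine ⟨d, k, fun p => ⟨fun hp => ?_, ?_⟩, hw.max, ?_, ?_, hw.descent_of_lt⟩
  · obtain ⟨i, rfl⟩ := hform p hp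
    have := he _ hp
    exact ⟨i, by omega, rfl⟩
  · rintro ⟨i, hi, rfl⟩
    exact hstep i (by omega)
  · intro i j hij hjk
    have hi := hstep i (by omega)
    by_contra h
    have hne : letter w (d + 2 * i + 1) ≠ letter w (d + 2 * j + 1) :=
      (letter_injective w).ne (by omega)
    exact hw.avoids321 (d + 2 * i) (d + 2 * i + 1) (d + 2 * j + 1) (by omega) (by omega) hi
      (by omega)
  · intro i hi
    exact (hw.descent_add_two hde he (hstep i (by omega)) (by omega)).2

end IsMinimalCrowded

end Minimal

end FCPerm

namespace FCPerm

/-! ### Consequences of minimality for the block -/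

section Characterization

variable {n : ℕ} {w : Equiv.Perm (Fin n)} {d k : ℕ}

/-- A position that cuts the one-line notation into a lower and an upper part is fixed. -/
lemma letter_eq_self_of_cut (w : Equiv.Perm (Fin n)) {i : ℕ}
    (h1 : ∀ q, q < i → letter w q < letter w i) (h2 : ∀ q, i < q → letter w i < letter w q) :
    letter w i = i := by
  apply le_antisymm
  · have := IsBlock.letter_le_card w (p := i) (Finset.range i) fun q hq => by
      rw [Finset.mem_range]
      by_contra h
      rcases (not_lt.1 h).eq_or_lt with rfl | h
      · omega
      · have := h2 q h
        omega
    rwa [Finset.card_range] at this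
  · have := IsBlock.card_le_letter w (p := i) (Finset.range i) fun q hq =>
      h1 q (Finset.mem_range.1 hq)
    rwa [Finset.card_range] at this

namespace IsBlock

lemma letter_eq_self (h : IsBlock (letter w) d k) {i : ℕ} (hi : ¬ (d ≤ i ∧ i ≤ d + 2 * k + 1)) :
    letter w i = i := by
  have key : ∀ p q, (p = i ∨ q = i) → p < q → letter w p < letter w q := by
    intro p q hpq hlt
    by_contra hge
    have hne : letter w p ≠ letter w q := (letter_injective w).ne hlt.ne
    obtain ⟨a, b, hab, hb, rfl, rfl⟩ := h.exists_of_inversion hlt (by omega)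
    omega
  exact letter_eq_self_of_cut w (fun q hq => key q i (Or.inr rfl) hq)
    fun q hq => key i q (Or.inl rfl) hq

lemma pos (h : IsBlock (letter w) d k) : 1 ≤ d ∧ d + 2 * k + 1 ≤ n := by
  have h0 := mem_of_descent w (h.descent (i := 0) (by omega))
  have hk := mem_of_descent w (h.descent (i := k) le_rfl)
  omega

lemma descents_eq (h : IsBlock (letter w) d k) :
    descents w = {j | ∃ i : ℕ, i ≤ k ∧ j = d + 2 * i} := by
  ext p
  simp only [descents, Set.mem_ofPred_eq, ← h.descent_iff]
  exact ⟨fun h => h.2.2, fun h => ⟨(mem_of_descent w h).1, (mem_of_descent w h).2, h⟩⟩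

/-- If no top exceeds the bottom two steps later, the set of tops is uncrowded. -/
lemma isUncrowded_of_forall_lt (h : IsBlock (letter w) d k)
    (hlt : ∀ i, i + 2 ≤ k → letter w (d + 2 * i) < letter w (d + 2 * (i + 2) + 1)) :
    IsUncrowded {z : ℤ | ∃ i < k + 1, z = (letter w (d + 2 * i) : ℤ)} := by
  refine isUncrowded_of_gaps (a := fun i => (letter w (d + 2 * i) : ℤ)) fun i j hij hj => ?_
  -- The top of index `i` is at most `d + 2i + 2`, and that of index `j` at least `d + 2j + 1`.
  have h1 := h.top_le (hlt i)
  have h2 := h.le_top (i := j) (m := 0) (by omega) (h.descent (by omega))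
  omega

/-- If no top exceeds the bottom three steps later, the set of all tops but the last one is
uncrowded. -/
lemma isUncrowded_init (h : IsBlock (letter w) d k)
    (hlt : ∀ i, i + 3 ≤ k → letter w (d + 2 * i) < letter w (d + 2 * (i + 3) + 1)) :
    IsUncrowded {z : ℤ | ∃ i < k, z = (letter w (d + 2 * i) : ℤ)} := by
  refine isUncrowded_of_gaps (a := fun i => (letter w (d + 2 * i) : ℤ)) fun i j hij hj => ?_
  have h1 := h.top_le (hlt i)
  have h2 := h.le_top (i := j) (m := 1) (by omega) (h.cross j hj)
  omega

/-- If some top exceeds the bottom three steps later, the set of all tops but the last one is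
crowded. -/
lemma isCrowded_init (h : IsBlock (letter w) d k) {i : ℕ} (hi : i + 3 ≤ k)
    (hlt : letter w (d + 2 * (i + 3) + 1) < letter w (d + 2 * i)) :
    IsCrowded {z : ℤ | ∃ i < k, z = (letter w (d + 2 * i) : ℤ)} := by
  have hinj : Function.Injective fun j => (letter w (d + 2 * j) : ℤ) := fun a b hab => by
    have := letter_injective w (Int.ofNat_inj.1 hab)
    omega
  refine isCrowded_of_card (letter w (d + 2 * i)) (letter w (d + 2 * (k - 1)))
    ((Finset.Ico i k).image fun j => (letter w (d + 2 * j) : ℤ)) ?_ ?_ ?_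
  · intro s hs
    obtain ⟨j, hj, rfl⟩ := Finset.mem_image.1 hs
    rw [Finset.mem_Ico] at hj
    refine ⟨⟨j, hj.2, rfl⟩, ?_, ?_⟩
    · rcases hj.1.eq_or_lt with rfl | hij
      · exact le_rfl
      · exact_mod_cast (h.top_lt hij).le
    · rcases (show j ≤ k - 1 by omega).eq_or_lt with rfl | hij
      · exact le_rfl
      · exact_mod_cast (h.top_lt hij).le
  · rw [Finset.image_nonempty, Finset.nonempty_Ico]
    omega
  · rw [Finset.card_image_of_injective _ hinj, Nat.card_Ico]
    -- The extreme tops are at least `d + 2i + 4` and at most `d + 2(k - 1) + 2`, too close for the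
    -- `k - i` tops they enclose.
    have h1 := h.le_top hi hlt
    have h2 := h.top_le (i := k - 1) (m := 2) fun _ => by omega
    omega

lemma window (h : IsBlock (letter w) d k) {i : ℕ} (hi : i + 2 ≤ k) :
    letter w (d + 2 * i + 1) < letter w (d + 2 * i + 3) ∧
      letter w (d + 2 * i + 3) < letter w (d + 2 * i + 5) ∧
      letter w (d + 2 * i + 3) < letter w (d + 2 * i) ∧
      letter w (d + 2 * i + 5) < letter w (d + 2 * i + 2) ∧
      letter w (d + 2 * i) < letter w (d + 2 * i + 2) ∧
      letter w (d + 2 * i + 2) < letter w (d + 2 * i + 4) :=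
  ⟨h.bottom_lt i (i + 1) (by omega) (by omega), h.bottom_lt (i + 1) (i + 2) (by omega) hi,
    h.cross i (by omega), h.cross (i + 1) (by omega), h.top_lt (show i < i + 1 by omega),
    h.top_lt (show i + 1 < i + 2 by omega)⟩

/-- The first letter of an occurrence of `415263` is a top, and the other three descents bottoms;
no top exceeds the bottom three steps later, so the occurrence is consecutive. -/
lemma isConsecutive_of_isOccurrence (h : IsBlock (letter w) d k)
    (hlt : ∀ i, i + 3 ≤ k → letter w (d + 2 * i) < letter w (d + 2 * (i + 3) + 1))
    {g : Fin 6 → ℕ} (hg : IsOccurrence ![4, 1, 5, 2, 6, 3] w g) : IsConsecutive g := by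
  obtain ⟨hmono, -, hord⟩ := hg
  rw [sameRelativeOrder_415263_iff] at hord
  obtain ⟨h1, h2, h3, h4, h5⟩ := hord
  have g01 : g 0 < g 1 := hmono (by decide)
  have g12 : g 1 < g 2 := hmono (by decide)
  have g23 : g 2 < g 3 := hmono (by decide)
  have g34 : g 3 < g 4 := hmono (by decide)
  have g45 : g 4 < g 5 := hmono (by decide)
  obtain ⟨i, j1, hij1, -, e0, e1⟩ := h.exists_of_inversion g01 (by omega)
  obtain ⟨i', j3, -, -, e0', e3⟩ :=
    h.exists_of_inversion (show g 0 < g 3 by omega) (by omega)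
  obtain ⟨i'', j5, -, hj5, e0'', e5⟩ :=
    h.exists_of_inversion (show g 0 < g 5 by omega) h3
  have hj : j5 < i + 3 := by
    by_contra hge
    have h6 := hlt i (by omega)
    rw [e0, e5] at h3
    rcases (not_lt.1 hge).eq_or_lt with rfl | hlt'
    · omega
    · have := h.bottom_lt _ _ hlt' hj5
      omega
  -- The last position is at most `d + 2(i + 2) + 1`, five after the first, which leaves no room for
  -- gaps among six positions.
  intro a b hab
  fin_cases a <;> fin_cases b <;> simp at hab ⊢ <;> omega

end IsBlock

namespace IsMinimalCrowded

lemma bumped_eq (hw : IsMinimalCrowded w) (h : IsBlock (letter w) d k) :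
    bumped (letter w) n = {z : ℤ | ∃ i < k + 1, z = (letter w (d + 2 * i) : ℤ)} :=
  h.bumped_eq (hw.mem_rows_snd_iff n)

lemma two_le (hw : IsMinimalCrowded w) (h : IsBlock (letter w) d k) : 2 ≤ k := by
  by_contra hk
  have := hw.isCrowded
  rw [hw.bumped_eq h] at this
  exact this (h.isUncrowded_of_forall_lt fun i hi => by omega)

lemma top_lt_bottom (hw : IsMinimalCrowded w) (h : IsBlock (letter w) d k)
    (i : ℕ) (hi : i + 3 ≤ k) :
    letter w (d + 2 * i) < letter w (d + 2 * (i + 3) + 1) := by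
  by_contra hlt
  have hne : letter w (d + 2 * i) ≠ letter w (d + 2 * (i + 3) + 1) :=
    (letter_injective w).ne (by omega)
  have hU := hw.isUncrowded_diff (h.descent (i := k) le_rfl)
    fun q hq => h.max_of_not_bottom (fun _ _ => by omega) (by omega)
  refine h.isCrowded_init hi (by omega) (hU.mono ?_)
  rw [hw.bumped_eq h]
  rintro _ ⟨j, hj, rfl⟩
  refine ⟨⟨j, by omega, rfl⟩, fun he => ?_⟩
  have := letter_injective w (Int.ofNat_inj.1 he)
  omega

lemma exists_isOccurrence (hw : IsMinimalCrowded w) (h : IsBlock (letter w) d k) :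
    ∃ f : Fin 6 → ℕ, IsOccurrence ![4, 1, 5, 2, 6, 3] w f := by
  have hC := hw.isCrowded
  rw [hw.bumped_eq h] at hC
  have hex : ∃ i, i + 2 ≤ k ∧ letter w (d + 2 * (i + 2) + 1) < letter w (d + 2 * i) := by
    by_contra! hno
    exact hC (h.isUncrowded_of_forall_lt fun i hi => lt_of_le_of_ne (hno i hi)
      ((letter_injective w).ne (by omega)))
  obtain ⟨i, hi, hlt⟩ := hex
  have hp := h.pos
  have hwin := h.window hi
  refine ⟨fun j => d + 2 * i + j, fun a b hab => ?_, fun j => ?_, ?_⟩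
  · have : (a : ℕ) < b := hab
    dsimp only
    omega
  · have := j.isLt
    dsimp only
    omega
  · rw [sameRelativeOrder_415263_iff]
    exact ⟨hwin.1, hwin.2.1, hlt, hwin.2.2.2.2.1, hwin.2.2.2.2.2⟩

end IsMinimalCrowded

/-! ### Sufficiency -/

lemma isBlock_of_conditions (hd : descents w = {j | ∃ i : ℕ, i ≤ k ∧ j = d + 2 * i})
    (hfix : ∀ i : ℕ, 1 ≤ i → i ≤ n → ¬ (d ≤ i ∧ i ≤ d + 2 * k + 1) → letter w i = i)
    (hcross : ∀ i, i < k → letter w (d + 2 * i + 3) < letter w (d + 2 * i))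
    (htop : ∀ i, i < k → letter w (d + 2 * i) < letter w (d + 2 * i + 2))
    (hbot : ∀ i, i < k → letter w (d + 2 * i + 1) < letter w (d + 2 * i + 3)) :
    IsBlock (letter w) d k := by
  have hdesc : ∀ p, letter w (p + 1) < letter w p ↔ ∃ i ≤ k, p = d + 2 * i := by
    intro p
    have : p ∈ descents w ↔ ∃ i ≤ k, p = d + 2 * i := by rw [hd]; rfl
    rw [← this]
    exact ⟨fun h => ⟨(mem_of_descent w h).1, (mem_of_descent w h).2, h⟩, fun h => h.2.2⟩
  have hfix' : ∀ i, ¬ (d ≤ i ∧ i ≤ d + 2 * k + 1) → letter w i = i := by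
    intro i hi
    by_cases h : 1 ≤ i ∧ i ≤ n
    · exact hfix i h.1 h.2 hi
    · exact letter_of_not_mem w h
  have hmem : ∀ i, d ≤ i ∧ i ≤ d + 2 * k + 1 → d ≤ letter w i ∧ letter w i ≤ d + 2 * k + 1 := by
    -- All positions outside the block are fixed, so the block is mapped to itself.
    intro i hi
    by_contra h
    have := letter_injective w (hfix' _ h)
    omega
  have hthird : ∀ p, letter w (p + 1) < letter w p → letter w p < letter w (p + 2) := by
    intro p hp
    obtain ⟨i, hi, rfl⟩ := (hdesc p).1 hp
    rcases hi.eq_or_lt with rfl | hi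
    · have h1 := hmem (d + 2 * i) (by omega)
      have h2 := hfix' (d + 2 * i + 2) (by omega)
      omega
    · exact htop i hi
  have hbot' : ∀ i j, i < j → j ≤ k → letter w (d + 2 * i + 1) < letter w (d + 2 * j + 1) := by
    intro i j hij
    induction j, hij using Nat.le_induction with
    | base => exact fun hj => hbot i (by omega)
    | succ j hj ih => exact fun hjk => (ih (by omega)).trans (hbot j (by omega))
  refine ⟨hdesc, lt_of_ascent (letter_injective w) hthird, hbot', hcross, ?_⟩
  intro p q hp hqp hlt
  obtain ⟨j, hj, rfl⟩ := (hdesc p).1 hp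
  rcases Nat.lt_or_ge q d with hqd | hqd
  · have h1 := hfix' q (by omega)
    have h2 := hmem (d + 2 * j + 1) (by omega)
    omega
  rcases Nat.even_or_odd' (q - d) with ⟨i, hi | hi⟩
  · exact (hdesc q).2 ⟨i, by omega, by omega⟩
  · obtain rfl : q = d + 2 * i + 1 := by omega
    have := hbot' i j (by omega) hj
    omega

namespace IsBlock

/-- A row entry above the coming bottom would be the top of an earlier descent, already bumped by
the induction hypothesis `hrows`. -/
lemma mem_rows_snd_iff (h : IsBlock (letter w) d k) (p z : ℕ) :
    z ∈ (rows (letter w) p).2 ↔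
      ∃ q, 1 ≤ q ∧ q + 1 ≤ p ∧ letter w (q + 1) < letter w q ∧ letter w q = z := by
  refine mem_rows_snd_iff_descent (letter_injective w) h.max (fun p hp hrows y hy => ?_) p z
  obtain ⟨q, hq1, hq2, rfl⟩ := (mem_rows (letter w) p y).1 (Or.inl hy)
  by_contra hlt
  have hne : letter w q ≠ letter w (p + 2) := (letter_injective w).ne (by omega)
  have hdq := h.descent_of_lt (p + 1) q hp (by omega)
    (show letter w (p + 2) < letter w q by omega)
  have hqp : q ≠ p := by
    rintro rfl
    obtain ⟨i, -, e1⟩ := (h.descent_iff _).1 hdq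
    obtain ⟨j, -, e2⟩ := (h.descent_iff _).1 hp
    omega
  exact rows_disjoint (letter_injective w) hy ((hrows _).2 ⟨q, hq1, by omega, hdq, rfl⟩)

/-- Below a block permutation all of whose proper initial segments of tops are uncrowded, a
crowded permutation has every bottom bump the top before it. -/
lemma exists_bump_of_le (h : IsBlock (letter w) d k)
    (hlt : ∀ i, i + 3 ≤ k → letter w (d + 2 * i) < letter w (d + 2 * (i + 3) + 1))
    {v : Equiv.Perm (Fin n)} (hle : RightWeakLE v w) (hv : IsCrowded (bumped (letter v) n))
    {i : ℕ} (hi : i ≤ k) :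
    ∃ r, letter w (d + 2 * i) ∈ (rows (letter v) r).1 ∧
      letter v (r + 1) = letter w (d + 2 * i + 1) ∧
      ∀ y ∈ (rows (letter v) r).1, letter v (r + 1) < y → letter w (d + 2 * i) ≤ y := by
  have hinv : ∀ {r z}, z ∈ (rows (letter v) r).1 → letter v (r + 1) < z →
      ∃ i j, i ≤ j ∧ j ≤ k ∧ z = letter w (d + 2 * i) ∧
        letter v (r + 1) = letter w (d + 2 * j + 1) := by
    intro r z hz hlt
    obtain ⟨q, hq1, hq2, rfl⟩ := (mem_rows _ _ _).1 (Or.inl hz)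
    exact h.exists_of_inv (hle.inv ((inv_letter_iff v q (r + 1)).2 ⟨hlt, by omega⟩))
  induction hN : k - i generalizing i with
  | zero =>
    obtain rfl : i = k := by omega
    -- Every letter bumped in `v` is a top of `w`; without the last top they would form an uncrowded
    -- set.
    have hmem : letter w (d + 2 * i) ∈ (rows (letter v) n).2 := by
      by_contra hnot
      refine hv ((h.isUncrowded_init hlt).mono ?_)
      rintro _ ⟨z, hz, rfl⟩
      obtain ⟨r, hr, hzr, hlt', -, -⟩ := exists_bump hz
      obtain ⟨a, b, hab, hb, rfl, -⟩ := hinv hzr hlt'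
      refine ⟨a, ?_, rfl⟩
      by_contra hai
      obtain rfl : a = i := by omega
      exact hnot hz
    obtain ⟨r, -, hzr, hlt', hmin, -⟩ := exists_bump hmem
    obtain ⟨a, b, hab, hb, he, hb'⟩ := hinv hzr hlt'
    have := letter_injective w he
    obtain rfl : b = i := by omega
    exact ⟨r, hzr, hb', hmin⟩
  | succ N ih =>
    obtain ⟨r, hr, hbr, hmin⟩ := ih (i := i + 1) (by omega) (by omega)
    have h1 : letter w (d + 2 * i) < letter w (d + 2 * (i + 1)) := h.top_lt (by omega)
    have h2 : letter w (d + 2 * (i + 1) + 1) < letter w (d + 2 * i) := h.cross i (by omega)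
    -- no inversion of `w` has a top as its lower letter, or a bottom as its upper letter
    have hnot1 : ∀ a b, ¬ Inv v (letter w a) (letter w (d + 2 * b)) := by
      intro a b hab
      obtain ⟨x, y, -, -, -, he⟩ := h.exists_of_inv (hle.inv hab)
      have := letter_injective w he
      omega
    have hnot2 : ∀ a b, ¬ Inv v (letter w (d + 2 * a + 1)) (letter w b) := by
      intro a b hab
      obtain ⟨x, y, -, -, he, -⟩ := h.exists_of_inv (hle.inv hab)
      have := letter_injective w he
      omega
    obtain ⟨q, hq1, hq2, hq⟩ := (mem_rows _ _ _).1 (Or.inl hr)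
    obtain ⟨t, ht⟩ := letter_surjective v (letter w (d + 2 * i))
    have htq : t < q := by
      by_contra hge
      have hne : q ≠ t := by
        rintro rfl
        omega
      refine hnot1 (d + 2 * (i + 1)) i ?_
      rw [← hq, ← ht, inv_letter_iff]
      omega
    have ht1 : 1 ≤ t := by
      by_contra ht0
      obtain rfl : t = 0 := by omega
      rw [letter_of_not_mem v (i := 0) (by omega)] at ht
      omega
    -- Top `i` precedes top `i + 1` in `v` and lies between bottom `i + 1` and top `i + 1`; still in
    -- the row, it would have been bumped instead.
    have hmem : letter w (d + 2 * i) ∈ (rows (letter v) r).2 := by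
      refine ((mem_rows _ r _).2 ⟨t, ht1, by omega, ht⟩).resolve_left fun hR => ?_
      have := hmin _ hR (by omega)
      omega
    obtain ⟨s, hs, hzs, hlt', hmin', -⟩ := exists_bump hmem
    obtain ⟨a, b, hab, hb, he, hb'⟩ := hinv hzs hlt'
    have hai : a = i := by
      have := letter_injective w he
      omega
    subst hai
    have hb3 : b < a + 3 := by
      by_contra hge
      have h3 := hlt a (by omega)
      rcases (not_lt.1 hge).eq_or_lt with rfl | h4
      · omega
      · have := h.bottom_lt _ _ h4 hb
        omega
    -- Bottom `b` precedes bottom `a + 1` in `v`, and bottoms stand in increasing order there.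
    have hb1 : b ≤ a + 1 := by
      by_contra hge
      refine hnot2 b (d + 2 * (a + 1) + 1) ?_
      rw [← hb', ← hbr, inv_letter_iff]
      refine ⟨?_, by omega⟩
      rw [hb', hbr]
      exact h.bottom_lt _ _ (by omega) hb
    have hba : b ≠ a + 1 := by
      rintro rfl
      have := letter_injective v (hb'.trans hbr.symm)
      omega
    obtain rfl : b = a := by omega
    exact ⟨s, hzs, hb', hmin'⟩

theorem isMinimalCrowded (h : IsBlock (letter w) d k)
    (hlt : ∀ i, i + 3 ≤ k → letter w (d + 2 * i) < letter w (d + 2 * (i + 3) + 1))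
    (hC : IsCrowded {z : ℤ | ∃ i < k + 1, z = (letter w (d + 2 * i) : ℤ)}) :
    IsMinimalCrowded w := by
  refine ⟨(mem_crowdedFC_iff w).2 ⟨h.avoids321, ?_⟩, fun v hv hle => ?_⟩
  · rwa [h.bumped_eq (h.mem_rows_snd_iff n)]
  · by_contra hne
    obtain ⟨p, hp, hnot⟩ := hle.exists_descent_not_inv hne
    obtain ⟨i, hi, rfl⟩ := (h.descent_iff p).1 hp
    obtain ⟨r, hr, hb, -⟩ := h.exists_bump_of_le hlt hle ((mem_crowdedFC_iff v).1 hv).2 hi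
    obtain ⟨q, -, hq, hqe⟩ := (mem_rows _ _ _).1 (Or.inl hr)
    refine hnot ?_
    rw [← hqe, ← hb, inv_letter_iff, hqe, hb]
    exact ⟨hp, by omega⟩

end IsBlock

/-- If every occurrence of `415263` is consecutive, no top exceeds the bottom three steps later. -/
lemma IsBlock.top_lt_of_isConsecutive (h : IsBlock (letter w) d k)
    (hcons : ∀ f : Fin 6 → ℕ, IsOccurrence ![4, 1, 5, 2, 6, 3] w f → IsConsecutive f) (i : ℕ)
    (hi : i + 3 ≤ k) : letter w (d + 2 * i) < letter w (d + 2 * (i + 3) + 1) := by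
  by_contra hlt
  have hne : letter w (d + 2 * i) ≠ letter w (d + 2 * (i + 3) + 1) :=
    (letter_injective w).ne (by omega)
  have hp := h.pos
  have hwin := h.window (i := i) (by omega)
  -- Replacing the last letter of the window by bottom `i + 3` gives an occurrence with a gap.
  have hocc : IsOccurrence ![4, 1, 5, 2, 6, 3] w ![d + 2 * i, d + 2 * i + 1, d + 2 * i + 2,
      d + 2 * i + 3, d + 2 * i + 4, d + 2 * (i + 3) + 1] := by
    refine ⟨?_, fun j => ?_, ?_⟩
    · rw [Fin.strictMono_iff_lt_succ]
      intro j
      fin_cases j <;> simp <;> omega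
    · fin_cases j <;> (simp; omega)
    · rw [sameRelativeOrder_415263_iff]
      exact ⟨hwin.1, h.bottom_lt (i + 1) (i + 3) (by omega) hi,
        show letter w (d + 2 * (i + 3) + 1) < letter w (d + 2 * i) by omega,
        hwin.2.2.2.2.1, hwin.2.2.2.2.2⟩
  have : d + 2 * (i + 3) + 1 = d + 2 * i + 4 + 1 := hcons _ hocc 4 5 rfl
  omega

end Characterization

end FCPerm

/-- The bound `1 ≤ d` is implicit: `d` is itself a descent. -/
theorem theorem5p15 (n : ℕ) (w : Equiv.Perm (Fin n)) :
    FCPerm.IsMinimalCrowded w ↔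
      ∃ d k : ℕ, 2 ≤ k ∧
        FCPerm.descents w = {j | ∃ i : ℕ, i ≤ k ∧ j = d + 2 * i} ∧
        FCPerm.IsCrowded {z : ℤ | ∃ i : ℕ, i ≤ k ∧ z = (FCPerm.letter w (d + 2 * i) : ℤ)} ∧
        (∀ i : ℕ, 1 ≤ i → i ≤ n → ¬ (d ≤ i ∧ i ≤ d + 2 * k + 1) → FCPerm.letter w i = i) ∧
        ((∃ f : Fin 6 → ℕ, FCPerm.IsOccurrence ![4, 1, 5, 2, 6, 3] w f) ∧
          ∀ f : Fin 6 → ℕ, FCPerm.IsOccurrence ![4, 1, 5, 2, 6, 3] w f →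
            FCPerm.IsConsecutive f) ∧
        (∀ i : ℕ, i + 2 ≤ k →
          FCPerm.SameRelativeOrder (fun j : Fin 6 => FCPerm.letter w (d + 2 * i + (j : ℕ)))
              ![4, 1, 5, 2, 6, 3] ∨
            FCPerm.SameRelativeOrder (fun j : Fin 6 => FCPerm.letter w (d + 2 * i + (j : ℕ)))
              ![3, 1, 5, 2, 6, 4]) := by
  have hset : ∀ d k : ℕ, {z : ℤ | ∃ i : ℕ, i ≤ k ∧ z = (FCPerm.letter w (d + 2 * i) : ℤ)} =
      {z : ℤ | ∃ i < k + 1, z = (FCPerm.letter w (d + 2 * i) : ℤ)} := by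
    intro d k
    simp only [Nat.lt_succ_iff]
  constructor
  · intro hw
    obtain ⟨d, k, h⟩ := hw.exists_isBlock
    refine ⟨d, k, hw.two_le h, h.descents_eq, ?_, fun i _ _ hi => h.letter_eq_self hi,
      ⟨hw.exists_isOccurrence h, fun f hf =>
        h.isConsecutive_of_isOccurrence (hw.top_lt_bottom h) hf⟩, fun i hi => ?_⟩
    · rw [hset, ← hw.bumped_eq h]
      exact hw.isCrowded
    · rw [FCPerm.sameRelativeOrder_415263_iff, FCPerm.sameRelativeOrder_315264_iff]
      obtain ⟨h1, h2, h3, h4, h5, h6⟩ := h.window hi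
      -- In a block only the comparison of the first and last letters of a window is undetermined;
      -- it selects the pattern.
      rcases lt_or_gt_of_ne ((FCPerm.letter_injective w).ne
        (show d + 2 * i ≠ d + 2 * i + 5 by omega)) with h7 | h7
      · exact Or.inr ⟨h1, h3, h7, h4, h6⟩
      · exact Or.inl ⟨h1, h2, h7, h5, h6⟩
  · rintro ⟨d, k, hk, hd, hC, hfix, ⟨-, hcons⟩, hwin⟩
    simp only [FCPerm.sameRelativeOrder_415263_iff, FCPerm.sameRelativeOrder_315264_iff] at hwin
    have hwin' : ∀ i, i + 2 ≤ k →
        FCPerm.letter w (d + 2 * i + 1) < FCPerm.letter w (d + 2 * i + 3) ∧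
        FCPerm.letter w (d + 2 * i + 3) < FCPerm.letter w (d + 2 * i + 5) ∧
        FCPerm.letter w (d + 2 * i + 3) < FCPerm.letter w (d + 2 * i) ∧
        FCPerm.letter w (d + 2 * i + 5) < FCPerm.letter w (d + 2 * i + 2) ∧
        FCPerm.letter w (d + 2 * i) < FCPerm.letter w (d + 2 * i + 2) ∧
        FCPerm.letter w (d + 2 * i + 2) < FCPerm.letter w (d + 2 * i + 4) := by
      intro i hi
      rcases hwin i hi with ⟨h1, h2, h3, h4, h5⟩ | ⟨h1, h2, h3, h4, h5⟩
      · exact ⟨h1, h2, h2.trans h3, h3.trans h4, h4, h5⟩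
      · exact ⟨h1, h2.trans h3, h2, h4, h3.trans h4, h5⟩
    -- each pair of consecutive descents lies in a window of three
    have hpair : ∀ i, i < k →
        FCPerm.letter w (d + 2 * i + 3) < FCPerm.letter w (d + 2 * i) ∧
        FCPerm.letter w (d + 2 * i) < FCPerm.letter w (d + 2 * i + 2) ∧
        FCPerm.letter w (d + 2 * i + 1) < FCPerm.letter w (d + 2 * i + 3) := by
      intro i hi
      by_cases hik : i + 2 ≤ k
      · have h := hwin' i hik
        exact ⟨h.2.2.1, h.2.2.2.2.1, h.1⟩
      · obtain ⟨i, rfl⟩ : ∃ i', i = i' + 1 := ⟨i - 1, by omega⟩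
        have h := hwin' i (by omega)
        exact ⟨h.2.2.2.1, h.2.2.2.2.2, h.2.1⟩
    have h := FCPerm.isBlock_of_conditions hd hfix (fun i hi => (hpair i hi).1)
      (fun i hi => (hpair i hi).2.1) (fun i hi => (hpair i hi).2.2)
    exact h.isMinimalCrowded (h.top_lt_of_isConsecutive hcons) (hset d k ▸ hC)
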